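/- Let $n\ge 2$ be an integer, let $J\colon\mathbb{R}^n\to\mathbb{R}$ be smooth and let $a,b,h>0$. Let $\mathbb{B}$ be the closed unit ball of $\mathbb{R}^n$, let $\bar J_a(x):=\frac{1}{\mathrm{vol}(\mathbb{B})}\int_{\mathbb{B}}J(x+a\xi)\,\mathrm{d}\xi$ and $c:=\mathrm{vol}(\mathbb{B})/(2\pi^{n-1})$. Define $\phi\colon\mathbb{R}^{n-1}\to\partial\mathbb{B}$ by letting $\phi(\vartheta_0,\dots,\vartheta_{n-2})$ be the vector with first coordinate $\cos\vartheta_0\prod_{j=1}^{n-2}\sin\vartheta_j$, second coordinate $\sin\vartheta_0\prod_{j=1}^{n-2}\sin\vartheta_j$ and, for $1\le i\le n-2$, $(i+2)$-nd coordinate $\cos\vartheta_i\prod_{j=i+1}^{n-2}\sin\vartheta_j$; and let $g(\vartheta):=\big|\prod_{j=1}^{n-2}\sin^{j}\vartheta_j\big|$. For every positive integer $k$ and $\tau\in\mathbb{R}$ put $\theta_k(\tau):=(\tau,2^{1\cdot k-1}\tau,\dots,2^{(n-2)k-1}\tau)$, $U_k(\tau):=\phi(\theta_k(\tau))$ and $v_k(\tau):=g(\theta_k(\tau))\,U_k(\tau)$.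 For $\omega>0$, a positive integer $k$ and a Lebesgue measurable, essentially bounded $d\colon\mathbb{R}\to\mathbb{R}$ with essential supremum norm $\|d\|$, consider the reduced system $$\dot{\bar x}(t)=a\,b\,c\,\nabla\bar J_a(\bar x(t))+b\,d(t)\,v_k(\omega t)\qquad(\mathrm{R})$$ in $\mathbb{R}^n$ and the (transformed) closed-loop system $$\dot{\tilde x}(t)=\big(J(\tilde x(t)+aU_k(\omega t))-\eta(t)+d(t)\big)\,b\,v_k(\omega t),\qquad \dot\eta(t)=-h\,\eta(t)+h\,J(\tilde x(t)+aU_k(\omega t))+h\,d(t)\qquad(\mathrm{C})$$ in $\mathbb{R}^n\times\mathbb{R}$; solutions are understood in the sense of Carathéodory. Let $\bar K,\tilde K\subset\mathbb{R}^n$ be compact with $\bar K\subset\mathrm{int}\,\tilde K$, and let $\delta,\rho>0$ be such that $|J(\tilde x+a\,s)|+\delta\le\rho$ for all $\tilde x\in\tilde K$ and $s\in\partial\mathbb{B}$. Then, for every $T>0$ and every $\varepsilon>0$, there exist $\omega_0>0$ and a positive integer $k_0$ such that, for every $\omega\ge\omega_0$, every integer $k\ge k_0$, every Lebesgue measurable,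 essentially bounded $d\colon\mathbb{R}\to\mathbb{R}$ with $\|d\|\le\delta$, every $t_0\in\mathbb{R}$, every $\tilde x_0\in\bar K$ and every $\eta_0\in\mathbb{R}$ with $|\eta_0|\le\rho$, the following holds: if the maximal solution $\bar x$ of $(\mathrm{R})$ with $\bar x(t_0)=\tilde x_0$ exists on $[t_0,t_0+T]$ and satisfies $\bar x(t)\in\bar K$ for all $t\in[t_0,t_0+T]$, then the maximal solution $(\tilde x,\eta)$ of $(\mathrm{C})$ with $\tilde x(t_0)=\tilde x_0$, $\eta(t_0)=\eta_0$ also exists on $[t_0,t_0+T]$ and satisfies $|\tilde x(t)-\bar x(t)|\le\varepsilon$ and $|\eta(t)|\le\rho$ for all $t\in[t_0,t_0+T]$. -/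

import Mathlib

open MeasureTheory
open scoped ENNReal

namespace AveragedES

noncomputable section

/-! Throughout, the dimension of the state space is `n = m + 2`, that is, an arbitrary integer
`n ≥ 2`; the state space is `EuclideanSpace ℝ (Fin (m + 2))` and vectors of angles are elements
of `Fin (m + 1) → ℝ`. -/

/-- `x` is a (Carathéodory) solution on the interval `I` of the initial value problem
`x' (t) = f t (x t)` for almost every `t`, `x t₀ = x₀`, in the usual integral form. -/
def IsSolution {E : Type*} [NormedAddCommGroup E] [NormedSpace ℝ E]
    (f : ℝ → E → E) (t₀ : ℝ) (x₀ : E) (I : Set ℝ) (x : ℝ → E) : Prop :=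
  I.OrdConnected ∧ t₀ ∈ I ∧
    ∀ t ∈ I, IntervalIntegrable (fun s => f s (x s)) volume t₀ t ∧
      x t = x₀ + ∫ s in t₀..t, f s (x s)

/-- `x`, with domain the interval `I`, is a maximal solution: no solution properly extends it.
(Values of `x` outside of `I` carry no meaning.) -/
def IsMaximalSolution {E : Type*} [NormedAddCommGroup E] [NormedSpace ℝ E]
    (f : ℝ → E → E) (t₀ : ℝ) (x₀ : E) (I : Set ℝ) (x : ℝ → E) : Prop :=
  IsSolution f t₀ x₀ I x ∧
    ∀ (I' : Set ℝ) (x' : ℝ → E), IsSolution f t₀ x₀ I' x' → I ⊆ I' → Set.EqOn x x' I → I' ⊆ I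

/-- Spherical coordinates `φ : ℝⁿ⁻¹ → ∂𝔹`. For `ϑ = (ϑ₀, …, ϑₙ₋₂)` the coordinates of `φ ϑ` are
`cos ϑ₀ sin ϑ₁ ⋯ sin ϑₙ₋₂`, `sin ϑ₀ sin ϑ₁ ⋯ sin ϑₙ₋₂`, `cos ϑ₁ sin ϑ₂ ⋯ sin ϑₙ₋₂`, …,
`cos ϑₙ₋₃ sin ϑₙ₋₂`, `cos ϑₙ₋₂`. -/
def sphParam {m : ℕ} (ϑ : Fin (m + 1) → ℝ) : EuclideanSpace ℝ (Fin (m + 2)) :=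
  WithLp.toLp 2 (Fin.cons (Real.cos (ϑ 0) * ∏ j ∈ Finset.Ioi 0, Real.sin (ϑ j))
    (fun i => (if i = 0 then Real.sin (ϑ 0) else Real.cos (ϑ i)) *
      ∏ j ∈ Finset.Ioi i, Real.sin (ϑ j)))

/-- The weight `g ϑ = |sin ϑ₁ sin² ϑ₂ ⋯ sinⁿ⁻² ϑₙ₋₂|` (the square root of the Gram determinant
of `φ`). -/
def gramWeight {m : ℕ} (ϑ : Fin (m + 1) → ℝ) : ℝ :=
  |∏ j : Fin (m + 1), Real.sin (ϑ j) ^ (j : ℕ)|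

/-- The curve of angles
`θ_k τ = (τ, 2 ^ (1 * k - 1) * τ, …, 2 ^ ((n - 2) * k - 1) * τ)`. -/
def angles (m k : ℕ) (τ : ℝ) : Fin (m + 1) → ℝ :=
  fun j => if j = 0 then τ else (2 : ℝ) ^ (((j : ℕ) : ℤ) * (k : ℤ) - 1) * τ

/-- The curve `U_k = φ ∘ θ_k` on the unit sphere. -/
def ditherU (m k : ℕ) (τ : ℝ) : EuclideanSpace ℝ (Fin (m + 2)) :=
  sphParam (angles m k τ)

/-- The dither signal `v_k = g (θ_k) U_k`. -/
def ditherV (m k : ℕ) (τ : ℝ) : EuclideanSpace ℝ (Fin (m + 2)) :=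
  gramWeight (angles m k τ) • ditherU m k τ

/-- The volume of the closed unit ball `𝔹` of `ℝⁿ`. -/
def ballVol (m : ℕ) : ℝ :=
  volume.real (Metric.closedBall (0 : EuclideanSpace ℝ (Fin (m + 2))) 1)

/-- The averaged objective function
`x ↦ (1 / vol 𝔹) ∫_𝔹 J (x + a ξ) dξ`. -/
def averagedObjective {m : ℕ} (J : EuclideanSpace ℝ (Fin (m + 2)) → ℝ) (a : ℝ)
    (x : EuclideanSpace ℝ (Fin (m + 2))) : ℝ :=
  1 / ballVol m *
    ∫ ξ in Metric.closedBall (0 : EuclideanSpace ℝ (Fin (m + 2))) 1, J (x + a • ξ)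

/-- The constant `c = vol 𝔹 / (2 π ^ (n - 1))`. -/
def gainConst (m : ℕ) : ℝ := ballVol m / (2 * Real.pi ^ (m + 1))

/-- Right-hand side of the reduced system
`x' = a b c ∇(averaged objective) (x) + b d(t) v_k(ω t)`. -/
def reducedField {m : ℕ} (J : EuclideanSpace ℝ (Fin (m + 2)) → ℝ) (a b ω : ℝ) (k : ℕ)
    (d : ℝ → ℝ) (t : ℝ) (x : EuclideanSpace ℝ (Fin (m + 2))) : EuclideanSpace ℝ (Fin (m + 2)) :=
  (a * b * gainConst m) • gradient (averagedObjective J a) x + (b * d t) • ditherV m k (ω * t)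

/-- Right-hand side of the transformed closed-loop system with state `z = (x, η)`:
`x' = J(x + a U_k(ω t)) b v_k(ω t) - η b v_k(ω t) + d(t) b v_k(ω t)`,
`η' = - h η + h J(x + a U_k(ω t)) + h d(t)`. -/
def closedLoopField {m : ℕ} (J : EuclideanSpace ℝ (Fin (m + 2)) → ℝ) (a b h ω : ℝ) (k : ℕ)
    (d : ℝ → ℝ) (t : ℝ) (z : EuclideanSpace ℝ (Fin (m + 2)) × ℝ) :
    EuclideanSpace ℝ (Fin (m + 2)) × ℝ :=
  ((J (z.1 + a • ditherU m k (ω * t)) * b) • ditherV m k (ω * t)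
      - (z.2 * b) • ditherV m k (ω * t) + (d t * b) • ditherV m k (ω * t),
    - h * z.2 + h * J (z.1 + a • ditherU m k (ω * t)) + h * d t)

end

end AveragedES

namespace AveragedES

open Set Filter Topology

/-! ### Carathéodory solutions -/

/-! This is an averaging argument. The disturbance enters (R) and the `x`-equation of (C) through
the same term `b d v_k`, so it cancels in the difference. It remains to compare `b (J(x + a U_k) -
η) v_k` with `a b c ∇` of the averaged objective.

Over one period `2π/ω` the state moves only `O(1/ω)`, so `x` and `η` may be frozen
(`norm_integral_period_le`). For large `k` the angular frequencies are widely separated, and the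
closed curve of angles equidistributes on the torus (`norm_integral_angles_sub_le`). The time
average of `J(x + a U_k) v_k` then approaches the torus average of `J(x + a φ) g φ`. Since `g` is
the surface density of `φ`, this is a multiple of a sphere integral of `J` times the outer normal,
and the divergence theorem (`integral_closedBall_fderiv`) turns it into the ball integral of `∇J`,
that is, into the averaged gradient; the constant `c` is the resulting normalisation. The case `J =
1` shows that `v_k` has almost zero mean, so the `η`-term averages out. Grönwall's inequality then
gives `norm_closedLoop_sub_reduced_le`.

That estimate presupposes that (C) exists and stays where `J` is controlled. So `J` is truncated and
`η` saturated, which yields a solution on the whole interval (`exists_isSolution_saturated`). A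
continuity argument (`le_half_of_bootstrap`) keeps it near the reduced solution, hence inside
`Ktilde`, and there the filter keeps `|η| ≤ ρ` because its input is bounded by `ρ`. Truncation and
saturation are thus never active, and uniqueness identifies this solution with the maximal solution
of (C). The disturbance matters only through `|d| ≤ δ`, whence the uniformity. -/

theorem le_mul_exp_of_le_add_integral {u : ℝ → ℝ} {a b e L : ℝ} (hL : 0 ≤ L)
    (hu : ContinuousOn u (Icc a b))
    (h : ∀ t ∈ Icc a b, u t ≤ e + L * ∫ s in a..t, u s) :
    ∀ t ∈ Icc a b, u t ≤ e * Real.exp (L * (t - a)) := by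
  intro t ht
  have hab : a ≤ b := ht.1.trans ht.2
  -- Grönwall is applied to the right-hand side of the inequality, since `u` itself need not be
  -- differentiable. Extending `u` by constants makes the primitive differentiable at the endpoints
  -- too.
  set v : ℝ → ℝ := IccExtend hab ((Icc a b).domRestrict u) with hv
  have hvc : Continuous v := (continuousOn_iff_continuous_domRestrict.1 hu).Icc_extend'
  have hvu : ∀ s ∈ Icc a b, v s = u s := fun s hs => by
    rw [hv, IccExtend_of_mem hab _ hs]; rfl
  have hint : ∀ s ∈ Icc a b, ∫ r in a..s, u r = ∫ r in a..s, v r := fun s hs =>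
    intervalIntegral.integral_congr fun r hr => by
      rw [uIcc_of_le hs.1] at hr
      exact (hvu r ⟨hr.1, hr.2.trans hs.2⟩).symm
  have hder : ∀ s, HasDerivAt (fun t => e + L * ∫ r in a..t, v r) (L * v s) s := fun s =>
    ((intervalIntegral.integral_hasDerivAt_right (hvc.intervalIntegrable _ _)
      (hvc.stronglyMeasurableAtFilter _ _) hvc.continuousAt).const_mul L).const_add e
  have key := le_gronwallBound_of_liminf_deriv_right_le
    (f := fun t => e + L * ∫ r in a..t, v r) (f' := fun s => L * v s) (δ := e) (K := L) (ε := 0)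
    (a := a) (b := b) (fun s _ => (hder s).continuousAt.continuousWithinAt)
    (fun s _ r hr => (hder s).hasDerivWithinAt.liminf_right_slope_le hr) (by simp)
    (fun s hs => by
      have hs' := Ico_subset_Icc_self hs
      rw [add_zero]
      have := h s hs'
      rw [hint s hs', ← hvu s hs'] at this
      exact mul_le_mul_of_nonneg_left this hL) t ht
  rw [gronwallBound_ε0] at key
  refine (h t ht).trans ?_
  rw [hint t ht]
  exact key

/-- Grönwall's inequality with zero initial error. Solutions may run backwards from `t₀`, and that
case follows by reflecting time. -/
theorem eq_zero_of_le_abs_integral {u : ℝ → ℝ} {a b L : ℝ} (hL : 0 ≤ L)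
    (hu : ContinuousOn u (uIcc a b)) (h0 : ∀ t ∈ uIcc a b, 0 ≤ u t)
    (h : ∀ t ∈ uIcc a b, u t ≤ L * |∫ s in a..t, u s|) :
    ∀ t ∈ uIcc a b, u t = 0 := by
  rcases le_total a b with hab | hab
  · rw [uIcc_of_le hab] at *
    intro t ht
    refine le_antisymm ?_ (h0 t ht)
    have := le_mul_exp_of_le_add_integral (e := 0) hL hu (fun s hs => by
      rw [zero_add]
      refine (h s hs).trans_eq ?_
      rw [abs_of_nonneg (intervalIntegral.integral_nonneg hs.1
        fun r hr => h0 r ⟨hr.1, hr.2.trans hs.2⟩)]) t ht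
    simpa using this
  · rw [uIcc_of_ge hab] at *
    intro t ht
    refine le_antisymm ?_ (h0 t ht)
    have := le_mul_exp_of_le_add_integral (u := fun s => u (-s)) (e := 0) (a := -a) (b := -b) hL
      (hu.comp continuous_neg.continuousOn fun s hs => ⟨by linarith [hs.2], by linarith [hs.1]⟩)
      (fun s hs => by
        have hs' : -s ∈ Icc b a := ⟨by linarith [hs.2], by linarith [hs.1]⟩
        rw [zero_add, intervalIntegral.integral_comp_neg (fun x => u x), neg_neg]
        refine (h (-s) hs').trans_eq ?_
        rw [intervalIntegral.integral_symm, abs_neg, abs_of_nonneg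
          (intervalIntegral.integral_nonneg hs'.2 fun r hr => h0 r ⟨hs'.1.trans hr.1, hr.2⟩)])
      (-t) ⟨by linarith [ht.2], by linarith [ht.1]⟩
    simpa using this

variable {E : Type*} [NormedAddCommGroup E] [NormedSpace ℝ E]

theorem IsSolution.continuousOn {f : ℝ → E → E} {t₀ : ℝ} {x₀ : E} {I : Set ℝ} {x : ℝ → E}
    (hx : IsSolution f t₀ x₀ I x) {t : ℝ} (ht : t ∈ I) : ContinuousOn x (uIcc t₀ t) := by
  refine ((intervalIntegral.continuousOn_primitive_interval' (hx.2.2 t ht).1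
    left_mem_uIcc).const_add x₀).congr fun s hs => ?_
  exact (hx.2.2 s (hx.1.uIcc_subset hx.2.1 ht hs)).2

theorem IsSolution.mono {f : ℝ → E → E} {t₀ : ℝ} {x₀ : E} {I I' : Set ℝ} {x : ℝ → E}
    (hx : IsSolution f t₀ x₀ I x) (h : I' ⊆ I) (hI : I'.OrdConnected) (ht : t₀ ∈ I') :
    IsSolution f t₀ x₀ I' x :=
  ⟨hI, ht, fun t ht => hx.2.2 t (h ht)⟩

/-- Lipschitz continuity in the state on bounded sets, uniformly in time. -/
def LipschitzOnBounded (f : ℝ → E → E) : Prop :=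
  ∀ R : ℝ, ∃ L : ℝ, 0 ≤ L ∧ ∀ s x y, ‖x‖ ≤ R → ‖y‖ ≤ R → ‖f s x - f s y‖ ≤ L * ‖x - y‖

theorem IsSolution.eqOn_uIcc {f : ℝ → E → E} (hf : LipschitzOnBounded f) {t₀ : ℝ} {x₀ : E}
    {I I' : Set ℝ} {x y : ℝ → E} (hx : IsSolution f t₀ x₀ I x) (hy : IsSolution f t₀ x₀ I' y)
    {t : ℝ} (ht : t ∈ I) (ht' : t ∈ I') : EqOn x y (uIcc t₀ t) := by
  have hxc := hx.continuousOn ht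
  have hyc := hy.continuousOn ht'
  obtain ⟨R₁, hR₁⟩ := isCompact_uIcc.exists_bound_of_continuousOn hxc
  obtain ⟨R₂, hR₂⟩ := isCompact_uIcc.exists_bound_of_continuousOn hyc
  obtain ⟨L, hL, hLip⟩ := hf (max R₁ R₂)
  have hc : ContinuousOn (fun s => ‖x s - y s‖) (uIcc t₀ t) := (hxc.sub hyc).norm
  have key := eq_zero_of_le_abs_integral hL hc (fun _ _ => norm_nonneg _) (fun r hr => by
    have hsub : uIcc t₀ r ⊆ uIcc t₀ t := uIcc_subset_uIcc left_mem_uIcc hr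
    obtain ⟨hi, he⟩ := hx.2.2 r (hx.1.uIcc_subset hx.2.1 ht hr)
    obtain ⟨hi', he'⟩ := hy.2.2 r (hy.1.uIcc_subset hy.2.1 ht' hr)
    rw [he, he', add_sub_add_left_eq_sub, ← intervalIntegral.integral_sub hi hi']
    nth_rewrite 1 [← abs_of_nonneg hL]
    rw [← abs_mul, ← intervalIntegral.integral_const_mul]
    refine intervalIntegral.norm_integral_le_abs_of_norm_le ?_
      ((hc.mono hsub).intervalIntegrable.const_mul L)
    refine (ae_restrict_iff' measurableSet_uIoc).2 (Eventually.of_forall fun s hs => ?_)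
    have hs' := hsub (uIoc_subset_uIcc hs)
    exact hLip s _ _ ((hR₁ s hs').trans (le_max_left _ _)) ((hR₂ s hs').trans (le_max_right _ _)))
  intro s hs
  exact sub_eq_zero.1 (norm_eq_zero.1 (key s hs))

/-- The integral equation at `t` sees only the values between `t₀` and `t`; this is what permits
gluing of solutions. -/
theorem isSolution_congr_at {f : ℝ → E → E} {t₀ t : ℝ} {x₀ : E} {x y : ℝ → E}
    (hxy : EqOn x y (uIcc t₀ t))
    (h : IntervalIntegrable (fun s => f s (x s)) volume t₀ t ∧
      x t = x₀ + ∫ s in t₀..t, f s (x s)) :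
    IntervalIntegrable (fun s => f s (y s)) volume t₀ t ∧
      y t = x₀ + ∫ s in t₀..t, f s (y s) := by
  refine ⟨h.1.congr fun s hs => ?_, ?_⟩
  · simp only [hxy (uIoc_subset_uIcc hs)]
  · rw [← hxy right_mem_uIcc, h.2]
    congr 1
    exact intervalIntegral.integral_congr fun s hs => by simp only [hxy hs]

/-- The domain consists of all times reached by some solution, and the value at `t` is taken from a
solution reaching `t`; uniqueness makes these choices consistent. No local existence is needed,
because the one-point domain always carries a solution. -/
theorem exists_isMaximalSolution {f : ℝ → E → E} (hf : LipschitzOnBounded f) (t₀ : ℝ) (x₀ : E) :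
    ∃ I x, IsMaximalSolution f t₀ x₀ I x := by
  classical
  let I : Set ℝ := {t | ∃ y, IsSolution f t₀ x₀ (uIcc t₀ t) y}
  have hmem : ∀ {I' : Set ℝ} {y : ℝ → E}, IsSolution f t₀ x₀ I' y → I' ⊆ I := fun hy t ht =>
    ⟨_, hy.mono (hy.1.uIcc_subset hy.2.1 ht) ordConnected_uIcc left_mem_uIcc⟩
  choose! y hy using fun t (ht : t ∈ I) => ht
  have ht₀ : t₀ ∈ I := by
    refine ⟨fun _ => x₀, ordConnected_uIcc, left_mem_uIcc, fun t ht => ?_⟩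
    rw [uIcc_self, mem_singleton_iff] at ht
    subst ht
    simp
  have hsub : ∀ t ∈ I, uIcc t₀ t ⊆ I := fun t ht => hmem (hy t ht)
  have hI : I.OrdConnected := by
    refine ordConnected_of_uIcc_subset_left (x := t₀) fun t ht => hsub t ht
  refine ⟨I, fun t => y t t, ⟨hI, ht₀, fun t ht => ?_⟩, fun I' x' hx' _ _ => hmem hx'⟩
  refine isSolution_congr_at (fun s hs => ?_) ((hy t ht).2.2 t right_mem_uIcc)
  exact (hy t ht).eqOn_uIcc hf (hy s (hsub t ht hs)) hs right_mem_uIcc right_mem_uIcc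

/-- Gluing the two solutions, which agree on the overlap by uniqueness, gives an extension that
maximality forbids to be proper. This is how a solution constructed by hand is recognised as part of
the maximal one. -/
theorem IsMaximalSolution.extends {f : ℝ → E → E} (hf : LipschitzOnBounded f) {t₀ : ℝ} {x₀ : E}
    {I I' : Set ℝ} {x y : ℝ → E} (hx : IsMaximalSolution f t₀ x₀ I x)
    (hy : IsSolution f t₀ x₀ I' y) : I' ⊆ I ∧ EqOn x y I' := by
  classical
  have hsub : I' ⊆ I := by
    have hz : EqOn (I.piecewise x y) x I := I.piecewise_eqOn x y
    have hz' : EqOn (I.piecewise x y) y I' := fun t ht => by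
      by_cases h : t ∈ I
      · rw [hz h]
        exact hx.1.eqOn_uIcc hf hy h ht right_mem_uIcc
      · exact piecewise_eq_of_notMem _ _ _ h
    refine subset_union_right.trans
      (hx.2 (I ∪ I') (I.piecewise x y) ⟨?_, Or.inl hx.1.2.1, ?_⟩ subset_union_left hz.symm)
    · refine ordConnected_of_uIcc_subset_left (x := t₀) fun t ht => ?_
      rcases ht with ht | ht
      · exact (hx.1.1.uIcc_subset hx.1.2.1 ht).trans subset_union_left
      · exact (hy.1.uIcc_subset hy.2.1 ht).trans subset_union_right
    · rintro t (ht | ht)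
      · exact isSolution_congr_at (fun s hs => (hz (hx.1.1.uIcc_subset hx.1.2.1 ht hs)).symm)
          (hx.1.2.2 t ht)
      · exact isSolution_congr_at (fun s hs => (hz' (hy.1.uIcc_subset hy.2.1 ht hs)).symm)
          (hy.2.2 t ht)
  exact ⟨hsub, fun t ht => hx.1.eqOn_uIcc hf hy (hsub ht) ht right_mem_uIcc⟩

/-- The merely integrable part `p` does not depend on the state. Subtracting its primitive `P`
leaves an equation for `y = x - P` with continuous right-hand side, to which Picard–Lindelöf
applies. -/
theorem exists_isSolution_add [CompleteSpace E] {g : ℝ → E → E} {p : ℝ → E} {K : NNReal} {M : ℝ}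
    (hg : Continuous fun q : ℝ × E => g q.1 q.2) (hK : ∀ t, LipschitzWith K (g t))
    (hM : ∀ t x, ‖g t x‖ ≤ M) (hp : ∀ s t, IntervalIntegrable p volume s t)
    {t₀ t₁ : ℝ} (ht : t₀ ≤ t₁) (x₀ : E) :
    ∃ x, IsSolution (fun t x => g t x + p t) t₀ x₀ (Icc t₀ t₁) x := by
  have hM0 : 0 ≤ M := (norm_nonneg _).trans (hM 0 0)
  set P : ℝ → E := fun t => ∫ s in t₀..t, p s with hP
  have hPc : Continuous P := intervalIntegral.continuous_primitive hp t₀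
  -- The ball of radius `M * (t₁ - t₀)` cannot be left before `t₁`, so the bounded, globally
  -- Lipschitz field gives existence on the whole interval.
  have hPL : IsPicardLindelof (fun t y => g t (y + P t)) (tmin := t₀) (tmax := t₁)
      ⟨t₀, left_mem_Icc.2 ht⟩ x₀ (⟨M, hM0⟩ * ⟨t₁ - t₀, sub_nonneg.2 ht⟩) 0 ⟨M, hM0⟩ K := by
    refine ⟨fun t _ => ?_, fun y _ => ?_, fun t _ y _ => hM _ _, ?_⟩
    · refine LipschitzWith.lipschitzOnWith ?_
      have := (hK t).comp ((LipschitzWith.id (α := E)).add (LipschitzWith.const (P t)))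
      rwa [add_zero, mul_one] at this
    · exact (hg.comp (continuous_id.prodMk (continuous_const.add hPc))).continuousOn
    · change M * max (t₁ - t₀) (t₀ - t₀) ≤ M * (t₁ - t₀) - 0
      simp [ht]
  obtain ⟨y, hy₀, hy⟩ := hPL.exists_eq_forall_mem_Icc_hasDerivWithinAt₀
  have hyc : ContinuousOn y (Icc t₀ t₁) := fun t ht => (hy t ht).continuousWithinAt
  refine ⟨fun t => y t + P t, ordConnected_Icc, left_mem_Icc.2 ht, fun t ht' => ?_⟩
  have hi : IntervalIntegrable (fun s => g s (y s + P s)) volume t₀ t := by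
    refine ContinuousOn.intervalIntegrable ?_
    rw [uIcc_of_le ht'.1]
    exact hg.comp_continuousOn (continuousOn_id.prodMk
      ((hyc.mono (Icc_subset_Icc_right ht'.2)).add hPc.continuousOn))
  refine ⟨hi.add (hp _ _), ?_⟩
  rw [intervalIntegral.integral_add hi (hp _ _), ← add_assoc,
    intervalIntegral.integral_eq_sub_of_hasDerivAt_of_le ht'.1 (f := y)
      (hyc.mono (Icc_subset_Icc_right ht'.2)) (fun s hs =>
      (hy s ⟨hs.1.le, hs.2.le.trans ht'.2⟩).hasDerivAt (Icc_mem_nhds hs.1 (hs.2.trans_le ht'.2))) hi]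
  simp only at hy₀
  rw [hy₀, add_sub_cancel]

end AveragedES

namespace AveragedES

open Set Filter Topology

/-! ### Spherical coordinates -/

theorem prod_Ioi_castSucc_snoc {n : ℕ} (i : Fin n) (f : Fin n → ℝ) (y : ℝ) (g : ℝ → ℝ) :
    ∏ j ∈ Finset.Ioi i.castSucc, g ((Fin.snoc f y : Fin (n + 1) → ℝ) j) =
      (∏ j ∈ Finset.Ioi i, g (f j)) * g y := by
  have : Finset.Ioi i.castSucc =
      Finset.cons (Fin.last n) ((Finset.Ioi i).map Fin.castSuccEmb) (by simp) := by
    ext j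
    refine Fin.lastCases ?_ (fun j => ?_) j
    · simp [Fin.castSucc_lt_last]
    · simp [Fin.le_last]
  rw [this, Finset.prod_cons, Finset.prod_map, Fin.snoc_last, mul_comm]
  simp

/-- Adding an angle `ψ` replaces the unit vector `φ` by `(sin ψ • φ, cos ψ)`. The inductions on the
dimension rest on this recursion. -/
theorem sphParam_snoc {m : ℕ} (ϑ : Fin (m + 1) → ℝ) (ψ : ℝ) :
    sphParam (Fin.snoc ϑ ψ : Fin (m + 2) → ℝ) =
      WithLp.toLp 2 (Fin.snoc (Real.sin ψ • sphParam ϑ).ofLp (Real.cos ψ) : Fin (m + 3) → ℝ) := by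
  unfold sphParam
  congr 1
  ext j
  refine Fin.cases ?_ (fun j => ?_) j
  · have h0 : (0 : Fin (m + 3)) = (0 : Fin (m + 2)).castSucc := rfl
    have h1 : (0 : Fin (m + 2)) = (0 : Fin (m + 1)).castSucc := rfl
    rw [h0, Fin.snoc_castSucc]
    simp only [Fin.castSucc_zero, Fin.cons_zero, PiLp.smul_apply, smul_eq_mul]
    rw [h1, prod_Ioi_castSucc_snoc 0 ϑ ψ Real.sin, Fin.snoc_castSucc]
    ring
  · refine Fin.lastCases ?_ (fun j => ?_) j
    · rw [Fin.succ_last, Fin.snoc_last, ← Fin.succ_last, Fin.cons_succ, Fin.snoc_last]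
      have : Finset.Ioi (Fin.last (m + 1)) = ∅ := by
        ext j; simp [Fin.le_last]
      simp [this]
    · rw [Fin.succ_castSucc, Fin.snoc_castSucc, ← Fin.succ_castSucc, Fin.cons_succ,
        prod_Ioi_castSucc_snoc j ϑ ψ Real.sin]
      have h1 : (0 : Fin (m + 2)) = (0 : Fin (m + 1)).castSucc := rfl
      simp only [PiLp.smul_apply, smul_eq_mul, Fin.cons_succ]
      rw [h1]
      simp only [Fin.snoc_castSucc, Fin.castSucc_inj]
      ring

theorem gramWeight_snoc {m : ℕ} (ϑ : Fin (m + 1) → ℝ) (ψ : ℝ) :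
    gramWeight (Fin.snoc ϑ ψ : Fin (m + 2) → ℝ) = gramWeight ϑ * |Real.sin ψ| ^ (m + 1) := by
  unfold gramWeight
  rw [Fin.prod_univ_castSucc, abs_mul, Fin.snoc_last, abs_pow]
  simp

theorem sphParam_zero (ϑ : Fin 1 → ℝ) :
    sphParam ϑ = !₂[Real.cos (ϑ 0), Real.sin (ϑ 0)] := by
  unfold sphParam
  congr 1
  ext j
  fin_cases j <;> simp

theorem gramWeight_zero (ϑ : Fin 1 → ℝ) : gramWeight ϑ = 1 := by simp [gramWeight]

theorem gramWeight_nonneg {m : ℕ} (ϑ : Fin (m + 1) → ℝ) : 0 ≤ gramWeight ϑ := abs_nonneg _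

theorem gramWeight_le_one {m : ℕ} (ϑ : Fin (m + 1) → ℝ) : gramWeight ϑ ≤ 1 := by
  unfold gramWeight
  rw [Finset.abs_prod]
  refine Finset.prod_le_one (fun _ _ => abs_nonneg _) fun j _ => ?_
  rw [abs_pow]
  exact pow_le_one₀ (abs_nonneg _) (Real.abs_sin_le_one _)

theorem norm_sphParam {m : ℕ} (ϑ : Fin (m + 1) → ℝ) : ‖sphParam ϑ‖ = 1 := by
  induction m with
  | zero => rw [sphParam_zero, EuclideanSpace.norm_eq]; simp
  | succ m ih =>
    rw [← Fin.snoc_init_self ϑ, sphParam_snoc, EuclideanSpace.norm_eq, Real.sqrt_eq_one,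
      Fin.sum_univ_castSucc]
    have h1 := ih (Fin.init ϑ)
    rw [EuclideanSpace.norm_eq, Real.sqrt_eq_one] at h1
    simp only [Fin.snoc_castSucc, Fin.snoc_last, PiLp.smul_apply, norm_smul, mul_pow,
      ← Finset.mul_sum]
    rw [h1]
    simp

theorem continuous_sphParam {m : ℕ} :
    Continuous (sphParam : (Fin (m + 1) → ℝ) → EuclideanSpace ℝ (Fin (m + 2))) := by
  refine (PiLp.continuous_toLp 2 _).comp (continuous_pi fun j => ?_)
  refine Fin.cases ?_ (fun i => ?_) j
  · simp only [Fin.cons_zero]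
    fun_prop
  · simp only [Fin.cons_succ]
    split_ifs <;> fun_prop

theorem continuous_gramWeight {m : ℕ} :
    Continuous (gramWeight : (Fin (m + 1) → ℝ) → ℝ) := by
  unfold gramWeight
  fun_prop

theorem sphParam_add_period {m : ℕ} (ϑ : Fin (m + 1) → ℝ) (n : Fin (m + 1) → ℤ) :
    sphParam (fun j => ϑ j + n j * (2 * Real.pi)) = sphParam ϑ := by
  unfold sphParam
  simp only [Real.sin_add_int_mul_two_pi, Real.cos_add_int_mul_two_pi]

theorem gramWeight_add_period {m : ℕ} (ϑ : Fin (m + 1) → ℝ) (n : Fin (m + 1) → ℤ) :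
    gramWeight (fun j => ϑ j + n j * (2 * Real.pi)) = gramWeight ϑ := by
  unfold gramWeight
  simp only [Real.sin_add_int_mul_two_pi]

theorem measurePreserving_snoc (μ : Measure ℝ) [SigmaFinite μ] (n : ℕ) :
    MeasurePreserving (fun p : ℝ × (Fin n → ℝ) => (Fin.snoc p.2 p.1 : Fin (n + 1) → ℝ))
      (μ.prod (Measure.pi fun _ => μ)) (Measure.pi fun _ => μ) := by
  have h := (measurePreserving_piFinSuccAbove (fun _ : Fin (n + 1) => μ) (Fin.last n)).symm
  convert h using 1
  ext p : 1
  exact (Fin.insertNth_last' p.1 p.2).symm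

theorem lintegral_pi_snoc (μ : Measure ℝ) [SigmaFinite μ] {n : ℕ} {F : (Fin (n + 1) → ℝ) → ℝ≥0∞}
    (hF : Measurable F) :
    ∫⁻ x, F x ∂(Measure.pi fun _ => μ) =
      ∫⁻ y, ∫⁻ z, F (Fin.snoc y z) ∂μ ∂(Measure.pi fun _ => μ) := by
  have h := measurePreserving_snoc μ n
  rw [← h.lintegral_comp hF]
  exact lintegral_prod_symm' _ (hF.comp h.measurable)

theorem integral_pi_snoc {E : Type*} [NormedAddCommGroup E] [NormedSpace ℝ E]
    (μ : Measure ℝ) [SigmaFinite μ] {n : ℕ} {F : (Fin (n + 1) → ℝ) → E}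
    (hF : Integrable F (Measure.pi fun _ => μ)) :
    ∫ x, F x ∂(Measure.pi fun _ => μ) =
      ∫ y, ∫ z, F (Fin.snoc y z) ∂μ ∂(Measure.pi fun _ => μ) := by
  have h := measurePreserving_snoc μ n
  have hF' := h.integrable_comp_of_integrable hF
  rw [← h.map_eq, integral_map h.measurable.aemeasurable (h.map_eq ▸ hF.aestronglyMeasurable)]
  exact integral_prod_symm _ hF'

theorem lintegral_euclidean_snoc {n : ℕ} {F : EuclideanSpace ℝ (Fin (n + 1)) → ℝ≥0∞}
    (hF : Measurable F) :
    ∫⁻ x, F x = ∫⁻ z : ℝ, ∫⁻ y : EuclideanSpace ℝ (Fin n),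
      F (WithLp.toLp 2 (Fin.snoc y.ofLp z)) := by
  have h₁ := PiLp.volume_preserving_toLp (Fin (n + 1))
  have hsn := measurePreserving_snoc (volume : Measure ℝ) n
  have hF₁ := hF.comp h₁.measurable
  rw [← h₁.lintegral_comp hF, volume_pi]
  refine (hsn.lintegral_comp hF₁).symm.trans ?_
  refine (lintegral_prod _ (hF₁.comp hsn.measurable).aemeasurable).trans ?_
  refine lintegral_congr fun z => ?_
  have h₂ := PiLp.volume_preserving_ofLp (Fin n)
  have := h₂.lintegral_comp (f := fun y => F (WithLp.toLp 2 (Fin.snoc y z)))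
    ((hF₁.comp hsn.measurable).comp measurable_prodMk_left)
  rw [this, volume_pi]
  rfl

/-- The product measure on the torus of angles, each angle ranging over `(-π, π]`. -/
noncomputable def angleMeasure (n : ℕ) : Measure (Fin n → ℝ) :=
  Measure.pi fun _ => volume.restrict (Ioc (-Real.pi) Real.pi)

instance (n : ℕ) : IsFiniteMeasure (angleMeasure n) := by
  unfold angleMeasure; infer_instance

theorem measurable_polar {m : ℕ} {F : EuclideanSpace ℝ (Fin (m + 2)) → ℝ≥0∞} (hF : Measurable F)
    {w : ℝ → ℝ} (hw : Continuous w) :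
    Measurable fun p : ℝ × (Fin (m + 1) → ℝ) =>
      ENNReal.ofReal (w p.1 * gramWeight p.2) * F (p.1 • sphParam p.2) := by
  have h1 : Continuous fun p : ℝ × (Fin (m + 1) → ℝ) => w p.1 * gramWeight p.2 :=
    (hw.comp continuous_fst).mul (continuous_gramWeight.comp continuous_snd)
  have h2 : Continuous fun p : ℝ × (Fin (m + 1) → ℝ) => p.1 • sphParam p.2 :=
    continuous_fst.smul (continuous_sphParam.comp continuous_snd)
  exact h1.measurable.ennreal_ofReal.mul (hF.comp h2.measurable)

/-- By the symmetry `x ↦ -x`, negative radii contribute as much as positive ones. Signed radii are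
needed in the induction, where the radius of the first coordinates becomes `r sin ψ` with `ψ` in a
full period. -/
theorem lintegral_polar_real_of_pos {m : ℕ}
    (h : ∀ F : EuclideanSpace ℝ (Fin (m + 2)) → ℝ≥0∞, Measurable F →
      2 ^ m * ∫⁻ x, F x = ∫⁻ r in Ioi (0 : ℝ), ∫⁻ ϑ,
        ENNReal.ofReal (r ^ (m + 1) * gramWeight ϑ) * F (r • sphParam ϑ) ∂angleMeasure (m + 1))
    {F : EuclideanSpace ℝ (Fin (m + 2)) → ℝ≥0∞} (hF : Measurable F) :
    2 ^ (m + 1) * ∫⁻ x, F x = ∫⁻ r : ℝ, ∫⁻ ϑ,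
        ENNReal.ofReal (|r| ^ (m + 1) * gramWeight ϑ) * F (r • sphParam ϑ)
          ∂angleMeasure (m + 1) := by
  have hpos : ∫⁻ r in Ioi (0 : ℝ), ∫⁻ ϑ,
      ENNReal.ofReal (|r| ^ (m + 1) * gramWeight ϑ) * F (r • sphParam ϑ) ∂angleMeasure (m + 1) =
      2 ^ m * ∫⁻ x, F x := by
    rw [h F hF]
    refine setLIntegral_congr_fun measurableSet_Ioi fun r hr => ?_
    simp only [abs_of_pos (mem_Ioi.1 hr)]
  have hneg : ∫⁻ r in Iic (0 : ℝ), ∫⁻ ϑ,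
      ENNReal.ofReal (|r| ^ (m + 1) * gramWeight ϑ) * F (r • sphParam ϑ) ∂angleMeasure (m + 1) =
      2 ^ m * ∫⁻ x, F x := by
    have hFn : Measurable fun x => F (-x) := hF.comp measurable_neg
    have h1 : ∫⁻ x, F x = ∫⁻ x, F (-x) :=
      ((Measure.measurePreserving_neg _).lintegral_comp hF).symm
    rw [h1, h _ hFn, ← setLIntegral_congr (Iio_ae_eq_Iic (a := (0 : ℝ)) (μ := volume)),
      ← (Measure.measurePreserving_neg (volume : Measure ℝ)).setLIntegral_comp_preimage_emb
        (MeasurableEquiv.neg ℝ).measurableEmbedding]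
    simp only [neg_preimage, neg_Iio, neg_zero]
    refine setLIntegral_congr_fun measurableSet_Ioi fun r hr => ?_
    simp only [abs_neg, abs_of_pos (mem_Ioi.1 hr), neg_smul]
  rw [← lintegral_add_compl _ (measurableSet_Ioi (a := (0 : ℝ))), compl_Ioi, hpos, hneg]
  ring

theorem lintegral_polarCoord {f : ℝ × ℝ → ℝ≥0∞} (hf : Measurable f) :
    ∫⁻ p, f p = ∫⁻ r in Ioi (0 : ℝ), ∫⁻ ψ in Ioc (-Real.pi) Real.pi,
      ENNReal.ofReal r * f (r * Real.cos ψ, r * Real.sin ψ) := by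
  rw [← lintegral_comp_polarCoord_symm, polarCoord_target, Measure.volume_eq_prod,
    ← Measure.prod_restrict, Measure.restrict_congr_set Ioo_ae_eq_Ioc, lintegral_prod]
  · simp only [polarCoord_symm_apply, smul_eq_mul]
  · refine Measurable.aemeasurable ?_
    simp only [polarCoord_symm_apply, smul_eq_mul]
    refine measurable_fst.ennreal_ofReal.mul (hf.comp ?_)
    fun_prop

/-- All `m + 1` angles range over a full period, whereas `m` of them would need only half of it;
hence the factor `2 ^ m`. -/
theorem lintegral_spherical {m : ℕ} {F : EuclideanSpace ℝ (Fin (m + 2)) → ℝ≥0∞}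
    (hF : Measurable F) :
    2 ^ m * ∫⁻ x, F x = ∫⁻ r in Ioi (0 : ℝ), ∫⁻ ϑ,
      ENNReal.ofReal (r ^ (m + 1) * gramWeight ϑ) * F (r • sphParam ϑ) ∂angleMeasure (m + 1) := by
  induction m with
  | zero =>
    have h₁ := PiLp.volume_preserving_toLp (Fin 2)
    have h₂ := (volume_preserving_finTwoArrow ℝ).symm
    rw [pow_zero, one_mul, ← h₁.lintegral_comp hF]
    refine (h₂.lintegral_comp (hF.comp h₁.measurable)).symm.trans ?_
    refine (lintegral_polarCoord ((hF.comp h₁.measurable).comp h₂.measurable)).trans ?_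
    refine lintegral_congr fun r => ?_
    have hm := (measurable_polar hF (continuous_pow 1)).comp (measurable_prodMk_left (x := r))
    unfold angleMeasure
    refine Eq.trans ?_ (lintegral_pi_snoc _ hm).symm
    rw [Measure.pi_of_empty, lintegral_dirac]
    refine lintegral_congr fun ψ => ?_
    simp only [Function.comp_apply]
    rw [gramWeight_zero, sphParam_zero, mul_one, pow_one]
    congr 2
    ext j
    fin_cases j <;> simp [Fin.snoc]
  | succ m ih =>
    -- Here `p.1` is the last coordinate and `p.2` the signed radius of the others. Plane polar
    -- coordinates for `p` create the new angle, and their Jacobian `r` turns `|r sin ψ| ^ (m + 1)`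
    -- into `r ^ (m + 2) |sin ψ| ^ (m + 1)`.
    set A : ℝ × ℝ → (Fin (m + 1) → ℝ) → ℝ≥0∞ := fun p ϑ =>
      ENNReal.ofReal (|p.2| ^ (m + 1) * gramWeight ϑ) *
        F (WithLp.toLp 2 (Fin.snoc (p.2 • sphParam ϑ).ofLp p.1)) with hA
    have hAm : Measurable fun q : (ℝ × ℝ) × (Fin (m + 1) → ℝ) => A q.1 q.2 := by
      have h1 : Continuous fun q : (ℝ × ℝ) × (Fin (m + 1) → ℝ) =>
          |q.1.2| ^ (m + 1) * gramWeight q.2 :=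
        (by fun_prop : Continuous fun q : (ℝ × ℝ) × (Fin (m + 1) → ℝ) => |q.1.2| ^ (m + 1)).mul
          (continuous_gramWeight.comp continuous_snd)
      have h2 : Continuous fun q : (ℝ × ℝ) × (Fin (m + 1) → ℝ) => q.1.2 • sphParam q.2 :=
        (by fun_prop : Continuous fun q : (ℝ × ℝ) × (Fin (m + 1) → ℝ) => q.1.2).smul
          (continuous_sphParam.comp continuous_snd)
      have h3 : Continuous fun q : (ℝ × ℝ) × (Fin (m + 1) → ℝ) =>
          (WithLp.toLp 2 (Fin.snoc (q.1.2 • sphParam q.2).ofLp q.1.1 : Fin (m + 3) → ℝ) :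
            EuclideanSpace ℝ (Fin (m + 3))) :=
        (PiLp.continuous_toLp 2 _).comp (((PiLp.continuous_ofLp 2 _).comp h2).finSnoc
          (by fun_prop : Continuous fun q : (ℝ × ℝ) × (Fin (m + 1) → ℝ) => q.1.1))
      exact h1.measurable.ennreal_ofReal.mul (hF.comp h3.measurable)
    have hB : Measurable fun p => ∫⁻ ϑ, A p ϑ ∂angleMeasure (m + 1) := hAm.lintegral_prod_right'
    have hG : ∀ z : ℝ, Measurable fun y : EuclideanSpace ℝ (Fin (m + 2)) =>
        F (WithLp.toLp 2 (Fin.snoc y.ofLp z)) := fun z =>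
      hF.comp ((PiLp.continuous_toLp 2 _).comp
        ((PiLp.continuous_ofLp 2 _).finSnoc continuous_const)).measurable
    rw [lintegral_euclidean_snoc hF, ← lintegral_const_mul' _ _ (by simp)]
    simp_rw [fun z => lintegral_polar_real_of_pos (fun F hF => ih hF) (hG z)]
    refine (lintegral_prod _ hB.aemeasurable).symm.trans ?_
    refine (lintegral_polarCoord hB).trans (lintegral_congr_ae ?_)
    filter_upwards [ae_restrict_mem measurableSet_Ioi] with r hr
    have hr : 0 < r := hr
    have hm := (measurable_polar hF (continuous_pow (m + 2))).comp
      (measurable_prodMk_left (x := r))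
    unfold angleMeasure
    refine Eq.trans ?_ (lintegral_pi_snoc _ hm).symm
    simp_rw [← lintegral_const_mul' _ _ (ENNReal.ofReal_ne_top (r := r))]
    have hc : Continuous fun ψ : ℝ => (r * Real.cos ψ, r * Real.sin ψ) := by fun_prop
    have hsw : Measurable fun q : ℝ × (Fin (m + 1) → ℝ) =>
        ENNReal.ofReal r * A (r * Real.cos q.1, r * Real.sin q.1) q.2 :=
      (hAm.comp ((hc.comp continuous_fst).prodMk continuous_snd).measurable).const_mul _
    rw [lintegral_lintegral_swap]
    · refine lintegral_congr fun ϑ => lintegral_congr fun ψ => ?_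
      simp only [Function.comp_apply]
      rw [gramWeight_snoc, sphParam_snoc, hA, ← mul_assoc, ← ENNReal.ofReal_mul hr.le]
      simp only
      congr 2
      · rw [abs_mul, abs_of_pos hr]; ring
      · congr 1
        ext j
        refine Fin.lastCases ?_ (fun j => ?_) j
        · simp
        · simp [mul_assoc]
    · exact hsw.aemeasurable

end AveragedES

namespace AveragedES

open Set Filter Topology

/-! ### The divergence theorem on the unit ball in spherical coordinates -/

/-- As a statement about measures, the formula for nonnegative functions passes to signed
integrands. -/
theorem spherical_measurePreserving (m : ℕ) :
    MeasurePreserving (fun p : ℝ × (Fin (m + 1) → ℝ) => p.1 • sphParam p.2)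
      (((volume.restrict (Ioi 0)).prod (angleMeasure (m + 1))).withDensity
        fun p => ENNReal.ofReal (p.1 ^ (m + 1) * gramWeight p.2))
      ((2 : ℝ≥0∞) ^ m • volume) := by
  have hc : Continuous fun p : ℝ × (Fin (m + 1) → ℝ) => p.1 • sphParam p.2 :=
    continuous_fst.smul (continuous_sphParam.comp continuous_snd)
  have hd : Measurable fun p : ℝ × (Fin (m + 1) → ℝ) =>
      ENNReal.ofReal (p.1 ^ (m + 1) * gramWeight p.2) :=
    ((continuous_fst.pow _).mul
      (continuous_gramWeight.comp continuous_snd)).measurable.ennreal_ofReal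
  refine ⟨hc.measurable, Measure.ext_of_lintegral _ fun F hF => ?_⟩
  rw [lintegral_map hF hc.measurable, lintegral_smul_measure, smul_eq_mul, lintegral_spherical hF]
  refine (lintegral_withDensity_eq_lintegral_mul _ hd (hF.comp hc.measurable)).trans ?_
  exact lintegral_prod _ (hd.mul (hF.comp hc.measurable)).aemeasurable

theorem integrable_and_integral_spherical {m : ℕ} {F : EuclideanSpace ℝ (Fin (m + 2)) → ℝ}
    (hF : Integrable F) :
    Integrable (fun p : ℝ × (Fin (m + 1) → ℝ) =>
        p.1 ^ (m + 1) * gramWeight p.2 * F (p.1 • sphParam p.2))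
      ((volume.restrict (Ioi 0)).prod (angleMeasure (m + 1))) ∧
    2 ^ m * ∫ x, F x = ∫ p : ℝ × (Fin (m + 1) → ℝ),
      p.1 ^ (m + 1) * gramWeight p.2 * F (p.1 • sphParam p.2)
        ∂((volume.restrict (Ioi 0)).prod (angleMeasure (m + 1))) := by
  have h := spherical_measurePreserving m
  have hd : Measurable fun p : ℝ × (Fin (m + 1) → ℝ) =>
      ENNReal.ofReal (p.1 ^ (m + 1) * gramWeight p.2) :=
    ((continuous_fst.pow _).mul
      (continuous_gramWeight.comp continuous_snd)).measurable.ennreal_ofReal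
  have hF' : Integrable F ((2 : ℝ≥0∞) ^ m • volume) := hF.smul_measure (by simp)
  have hpos : ∀ᵐ p ∂((volume.restrict (Ioi (0 : ℝ))).prod (angleMeasure (m + 1))),
      (ENNReal.ofReal (p.1 ^ (m + 1) * gramWeight p.2)).toReal • F (p.1 • sphParam p.2) =
        p.1 ^ (m + 1) * gramWeight p.2 * F (p.1 • sphParam p.2) := by
    have : ∀ᵐ p ∂((volume.restrict (Ioi (0 : ℝ))).prod (angleMeasure (m + 1))), p.1 ∈ Ioi (0 : ℝ) :=
      Measure.quasiMeasurePreserving_fst.ae (ae_restrict_mem measurableSet_Ioi)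
    filter_upwards [this] with p hp
    rw [ENNReal.toReal_ofReal (mul_nonneg (pow_nonneg (le_of_lt hp) _) (gramWeight_nonneg _)),
      smul_eq_mul]
  constructor
  · have h1 := h.integrable_comp_of_integrable hF'
    rw [integrable_withDensity_iff_integrable_smul' hd (by simp)] at h1
    exact h1.congr hpos
  · have h1 : 2 ^ m * ∫ x, F x = ∫ x, F x ∂((2 : ℝ≥0∞) ^ m • (volume : Measure
        (EuclideanSpace ℝ (Fin (m + 2))))) := by
      rw [integral_smul_measure]; simp
    rw [h1, ← h.map_eq, integral_map h.measurable.aemeasurable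
      (h.map_eq ▸ hF'.aestronglyMeasurable),
      integral_withDensity_eq_integral_toReal_smul hd (by simp)]
    exact integral_congr_ae hpos

variable {m : ℕ}

theorem hasFDerivAt_comp_norm_sq {q : ℝ → ℝ} (hq : ContDiff ℝ 1 q)
    (x : EuclideanSpace ℝ (Fin (m + 2))) :
    HasFDerivAt (fun y : EuclideanSpace ℝ (Fin (m + 2)) => q (‖y‖ ^ 2))
      (deriv q (‖x‖ ^ 2) • (2 • (innerSL ℝ x))) x := by
  have h1 := (hasStrictFDerivAt_norm_sq x).hasFDerivAt
  have h2 := (hq.differentiable one_ne_zero (‖x‖ ^ 2)).hasDerivAt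
  exact h2.comp_hasFDerivAt x h1

/-- Integration by parts moves the derivative onto the radial cutoff, whose gradient is radial and
so produces the normal component `sphParam ϑ i`. A second integration by parts, in `r` along each
ray, moves it back. -/
theorem integral_fderiv_mul_cutoff {f : EuclideanSpace ℝ (Fin (m + 2)) → ℝ} (hf : ContDiff ℝ 1 f)
    {q : ℝ → ℝ} (hq : ContDiff ℝ 1 q) (hq1 : ∀ t, t ≤ 1 → q t = 1) (hq2 : ∀ t, 2 ≤ t → q t = 0)
    (i : Fin (m + 2)) :
    2 ^ m * ∫ x, fderiv ℝ f x (EuclideanSpace.single i 1) * q (‖x‖ ^ 2) =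
      ∫ ϑ, gramWeight ϑ * sphParam ϑ i * (f (sphParam ϑ) + ∫ r in (1 : ℝ)..2, q (r ^ 2) *
        ((m + 1) * r ^ m * f (r • sphParam ϑ) +
          r ^ (m + 1) * fderiv ℝ f (r • sphParam ϑ) (sphParam ϑ))) ∂angleMeasure (m + 1) := by
  set e : EuclideanSpace ℝ (Fin (m + 2)) := EuclideanSpace.single i 1 with he
  set Q : EuclideanSpace ℝ (Fin (m + 2)) → ℝ := fun y => q (‖y‖ ^ 2) with hQ
  have hQd : Differentiable ℝ Q := fun x => (hasFDerivAt_comp_norm_sq hq x).differentiableAt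
  have hQe : ∀ x, fderiv ℝ Q x e = 2 * deriv q (‖x‖ ^ 2) * x i := fun x => by
    rw [(hasFDerivAt_comp_norm_sq hq x).fderiv]
    simp [he, EuclideanSpace.inner_single_right]
    ring
  have hq' : Continuous (deriv q) := hq.continuous_deriv le_rfl
  have hqc : Continuous q := hq.continuous
  have hq'2 : ∀ t, 2 < t → deriv q t = 0 := fun t ht => by
    have : q =ᶠ[𝓝 t] fun _ => 0 := by
      filter_upwards [lt_mem_nhds ht] with s hs using hq2 s hs.le
    rw [this.deriv_eq, deriv_const]
  have hQs : HasCompactSupport Q := by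
    refine HasCompactSupport.intro (isCompact_closedBall 0 2) fun x hx => ?_
    rw [mem_closedBall_zero_iff, not_le] at hx
    exact hq2 _ (by nlinarith)
  have hQ's : HasCompactSupport fun x => fderiv ℝ Q x e := by
    refine HasCompactSupport.intro (isCompact_closedBall 0 2) fun x hx => ?_
    rw [mem_closedBall_zero_iff, not_le] at hx
    rw [hQe, hq'2 _ (by nlinarith)]
    simp
  have hfc : Continuous f := hf.continuous
  have hf' : Continuous fun x => fderiv ℝ f x := hf.continuous_fderiv one_ne_zero
  have hQc : Continuous Q := hQd.continuous
  have hQ'c : Continuous fun x => fderiv ℝ Q x e := by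
    simp only [hQe]; fun_prop
  have hint : Integrable fun x => f x * fderiv ℝ Q x e :=
    (hfc.mul hQ'c).integrable_of_hasCompactSupport hQ's.mul_left
  have hparts : ∫ x, f x * fderiv ℝ Q x e = - ∫ x, fderiv ℝ f x e * Q x := by
    refine integral_mul_fderiv_eq_neg_fderiv_mul_of_integrable ?_ hint ?_
      (fun x _ => hf.differentiable one_ne_zero x) (fun x _ => hQd x)
    · exact ((hf'.clm_apply continuous_const).mul hQc).integrable_of_hasCompactSupport hQs.mul_left
    · exact (hfc.mul hQc).integrable_of_hasCompactSupport hQs.mul_left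
  obtain ⟨hpi, hpe⟩ := integrable_and_integral_spherical hint
  rw [← neg_inj, ← mul_neg, ← hparts, hpe, integral_prod_symm _ hpi, ← integral_neg]
  refine integral_congr_ae (Eventually.of_forall fun ϑ => ?_)
  simp only
  set s := sphParam ϑ with hs
  have hns : ‖s‖ = 1 := norm_sphParam ϑ
  set H : ℝ → ℝ := fun r => r ^ (m + 1) * f (r • s) with hH
  set H' : ℝ → ℝ := fun r => (m + 1) * r ^ m * f (r • s) + r ^ (m + 1) * fderiv ℝ f (r • s) s
    with hH'
  have hHd : ∀ r, HasDerivAt H (H' r) r := fun r => by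
    have h1 : HasDerivAt (fun r : ℝ => f (r • s)) (fderiv ℝ f (r • s) s) r := by
      have h2 : HasDerivAt (fun r : ℝ => r • s) s r := by
        simpa using (hasDerivAt_id r).smul_const s
      exact (hf.differentiable one_ne_zero (r • s)).hasFDerivAt.comp_hasDerivAt r h2
    have h3 := (hasDerivAt_pow (m + 1) r).mul h1
    simpa using! h3
  have hH'c : Continuous H' := by
    have : Continuous fun r : ℝ => fderiv ℝ f (r • s) s :=
      (hf'.comp (by fun_prop : Continuous fun r : ℝ => r • s)).clm_apply continuous_const
    fun_prop
  set p : ℝ → ℝ := fun r => q (r ^ 2) with hp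
  set p' : ℝ → ℝ := fun r => deriv q (r ^ 2) * (2 * r) with hp'
  have hpd : ∀ r, HasDerivAt p (p' r) r := fun r => by
    have h2 := (hq.differentiable one_ne_zero (r ^ 2)).hasDerivAt
    simpa using! HasDerivAt.comp (h := fun x : ℝ => x ^ 2) r h2 (hasDerivAt_pow 2 r)
  have hp'c : Continuous p' := by fun_prop
  have hpc : Continuous p := by fun_prop
  have h1 : ∫ r in Ioi (0 : ℝ), r ^ (m + 1) * gramWeight ϑ * (f (r • s) * fderiv ℝ Q (r • s) e) =
      gramWeight ϑ * s i * ∫ r in (0 : ℝ)..2, H r * p' r := by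
    rw [intervalIntegral.integral_of_le zero_le_two, ← integral_const_mul]
    symm
    refine (setIntegral_eq_of_subset_of_forall_sdiff_eq_zero measurableSet_Ioi Ioc_subset_Ioi_self
      fun r hr => ?_).symm.trans (setIntegral_congr_fun measurableSet_Ioi fun r hr => ?_)
    · have h2 : 2 < r := by
        by_contra h
        exact hr.2 ⟨hr.1, not_lt.1 h⟩
      simp only [hp']
      rw [hq'2 _ (by nlinarith)]
      ring
    · simp only [hQe, hH, hp', norm_smul, hns, Real.norm_eq_abs, mul_one, sq_abs, PiLp.smul_apply,
        smul_eq_mul]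
      ring
  have h2 : ∫ r in (0 : ℝ)..2, H r * p' r = - ∫ r in (0 : ℝ)..2, H' r * p r := by
    rw [intervalIntegral.integral_mul_deriv_eq_deriv_mul (fun r _ => hHd r) (fun r _ => hpd r)
      (hH'c.intervalIntegrable _ _) (hp'c.intervalIntegrable _ _)]
    have : p 2 = 0 := hq2 _ (by norm_num)
    simp [this, hH]
  -- The cutoff is one on the unit ball, so this piece is `H 1 - H 0`, and `H 0 = 0`. It is the
  -- boundary term of the divergence theorem.
  have h3 : ∫ r in (0 : ℝ)..1, H' r * p r = f s := by
    have : ∫ r in (0 : ℝ)..1, H' r * p r = ∫ r in (0 : ℝ)..1, H' r :=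
      intervalIntegral.integral_congr fun r hr => by
        rw [uIcc_of_le zero_le_one] at hr
        simp only [hp]
        rw [hq1 _ (by nlinarith [hr.1, hr.2]), mul_one]
    rw [this, intervalIntegral.integral_eq_sub_of_hasDerivAt (fun r _ => hHd r)
      (hH'c.intervalIntegrable _ _)]
    simp [hH]
  have h4 := intervalIntegral.integral_add_adjacent_intervals (μ := volume)
    ((hH'c.mul hpc).intervalIntegrable 0 1) ((hH'c.mul hpc).intervalIntegrable 1 2)
  simp only [Pi.mul_apply] at h4
  rw [h1, h2, ← h4, h3, mul_neg]
  congr 3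
  exact intervalIntegral.integral_congr fun r _ => mul_comm _ _

/-- A sequence of smooth cutoff functions decreasing to the indicator of `(-∞, 1]`. -/
noncomputable def cutoff (N : ℕ) (t : ℝ) : ℝ := Real.smoothTransition ((N + 1) * (1 - t) + 1)

theorem cutoff_of_le_one (N : ℕ) {t : ℝ} (ht : t ≤ 1) : cutoff N t = 1 :=
  Real.smoothTransition.one_of_one_le (by nlinarith [(Nat.cast_nonneg N : (0 : ℝ) ≤ N)])

theorem cutoff_eq_zero (N : ℕ) {t : ℝ} (ht : 1 ≤ (N + 1) * (t - 1)) : cutoff N t = 0 :=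
  Real.smoothTransition.zero_of_nonpos (by linarith)

theorem contDiff_cutoff (N : ℕ) : ContDiff ℝ 1 (cutoff N) :=
  Real.smoothTransition.contDiff.comp (by fun_prop)

theorem abs_cutoff_le_one (N : ℕ) (t : ℝ) : |cutoff N t| ≤ 1 := by
  unfold cutoff
  rw [abs_of_nonneg (Real.smoothTransition.nonneg _)]
  exact Real.smoothTransition.le_one _

theorem cutoff_eq_zero_of_two_le (N : ℕ) {t : ℝ} (ht : 2 ≤ t) : cutoff N t = 0 :=
  cutoff_eq_zero N (by nlinarith [(Nat.cast_nonneg N : (0 : ℝ) ≤ N)])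

theorem tendsto_cutoff {t : ℝ} (ht : 1 < t) : Tendsto (fun N => cutoff N t) atTop (𝓝 0) := by
  refine tendsto_const_nhds.congr' ?_
  obtain ⟨M, hM⟩ := exists_nat_ge (1 / (t - 1))
  filter_upwards [eventually_ge_atTop M] with N hN
  refine (cutoff_eq_zero N ?_).symm
  rw [div_le_iff₀ (by linarith)] at hM
  have : (M : ℝ) ≤ N := by exact_mod_cast hN
  nlinarith

theorem tendsto_integral_mul_cutoff_norm {F : EuclideanSpace ℝ (Fin (m + 2)) → ℝ}
    (hF : Continuous F) :
    Tendsto (fun N => ∫ x, F x * cutoff N (‖x‖ ^ 2)) atTop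
      (𝓝 (∫ x in Metric.closedBall 0 1, F x)) := by
  rw [← integral_indicator Metric.isClosed_closedBall.measurableSet]
  refine tendsto_integral_of_dominated_convergence
    ((Metric.closedBall 0 2).indicator fun x => |F x|) (fun N => ?_) ?_ (fun N => ?_) ?_
  · have := (contDiff_cutoff N).continuous
    exact (by fun_prop : Continuous fun x => F x * cutoff N (‖x‖ ^ 2)).aestronglyMeasurable
  · rw [integrable_indicator_iff Metric.isClosed_closedBall.measurableSet]
    exact hF.abs.continuousOn.integrableOn_compact (isCompact_closedBall _ _)
  · refine Eventually.of_forall fun x => ?_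
    by_cases hx : x ∈ Metric.closedBall (0 : EuclideanSpace ℝ (Fin (m + 2))) 2
    · rw [indicator_of_mem hx, Real.norm_eq_abs, abs_mul]
      exact mul_le_of_le_one_right (abs_nonneg _) (abs_cutoff_le_one _ _)
    · rw [indicator_of_notMem hx]
      rw [mem_closedBall_zero_iff, not_le] at hx
      rw [cutoff_eq_zero_of_two_le N (by nlinarith)]
      simp
  · refine Eventually.of_forall fun x => ?_
    by_cases hx : x ∈ Metric.closedBall (0 : EuclideanSpace ℝ (Fin (m + 2))) 1
    · rw [indicator_of_mem hx]
      rw [mem_closedBall_zero_iff] at hx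
      refine tendsto_const_nhds.congr fun N => ?_
      rw [cutoff_of_le_one N (by nlinarith [norm_nonneg x]), mul_one]
    · rw [indicator_of_notMem hx]
      rw [mem_closedBall_zero_iff, not_le] at hx
      simpa using (tendsto_cutoff (t := ‖x‖ ^ 2) (by nlinarith)).const_mul (F x)

/-- The divergence theorem for `f` times the `i`-th basis vector, obtained by sharpening the cutoff.
The shell integral over `1 < r ≤ 2` vanishes in the limit by dominated convergence. -/
theorem integral_closedBall_fderiv {f : EuclideanSpace ℝ (Fin (m + 2)) → ℝ} (hf : ContDiff ℝ 1 f)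
    (i : Fin (m + 2)) :
    2 ^ m * ∫ x in Metric.closedBall 0 1, fderiv ℝ f x (EuclideanSpace.single i 1) =
      ∫ ϑ, gramWeight ϑ * sphParam ϑ i * f (sphParam ϑ) ∂angleMeasure (m + 1) := by
  have hf' : Continuous fun x => fderiv ℝ f x := hf.continuous_fderiv one_ne_zero
  have hL := (tendsto_integral_mul_cutoff_norm (m := m)
    (hf'.clm_apply (continuous_const (y := EuclideanSpace.single i 1)))).const_mul (2 ^ m)
  refine tendsto_nhds_unique hL ?_
  simp_rw [fun N => integral_fderiv_mul_cutoff hf (contDiff_cutoff N)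
    (fun t ht => cutoff_of_le_one N ht) (fun t ht => cutoff_eq_zero_of_two_le N ht) i]
  obtain ⟨M₀, hM₀⟩ := (isCompact_closedBall (0 : EuclideanSpace ℝ (Fin (m + 2))) 2
    ).exists_bound_of_continuousOn hf.continuous.continuousOn
  obtain ⟨M₁, hM₁⟩ := (isCompact_closedBall (0 : EuclideanSpace ℝ (Fin (m + 2))) 2
    ).exists_bound_of_continuousOn hf'.continuousOn
  set H' : (Fin (m + 1) → ℝ) → ℝ → ℝ := fun ϑ r => (m + 1) * r ^ m * f (r • sphParam ϑ) +
          r ^ (m + 1) * fderiv ℝ f (r • sphParam ϑ) (sphParam ϑ) with hH'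
  have hsc := continuous_sphParam (m := m)
  have hgc := continuous_gramWeight (m := m)
  have hH'c : Continuous fun q : (Fin (m + 1) → ℝ) × ℝ => H' q.1 q.2 := by
    have h1 : Continuous fun q : (Fin (m + 1) → ℝ) × ℝ => q.2 • sphParam q.1 := by fun_prop
    have h2 : Continuous fun q : (Fin (m + 1) → ℝ) × ℝ =>
        fderiv ℝ f (q.2 • sphParam q.1) (sphParam q.1) :=
      (hf'.comp h1).clm_apply (hsc.comp continuous_fst)
    have h3 := hf.continuous.comp h1
    simp only [Function.comp_def] at h3
    fun_prop
  set C : ℝ := (m + 1) * 2 ^ m * M₀ + 2 ^ (m + 1) * M₁ with hC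
  have hbd : ∀ ϑ, ∀ r ∈ Icc (1 : ℝ) 2, |H' ϑ r| ≤ C := fun ϑ r hr => by
    have hr0 : 0 ≤ r := zero_le_one.trans hr.1
    have hmem : r • sphParam ϑ ∈ Metric.closedBall (0 : EuclideanSpace ℝ (Fin (m + 2))) 2 := by
      rw [mem_closedBall_zero_iff, norm_smul, norm_sphParam, mul_one, Real.norm_eq_abs,
        abs_of_nonneg hr0]
      exact hr.2
    have h0 := hM₀ _ hmem
    have h1 := ((fderiv ℝ f (r • sphParam ϑ)).le_opNorm (sphParam ϑ)).trans
      (by rw [norm_sphParam, mul_one] : _ ≤ ‖fderiv ℝ f (r • sphParam ϑ)‖)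
    replace h1 := h1.trans (hM₁ _ hmem)
    have hM00 := (norm_nonneg _).trans h0
    have hM11 := (norm_nonneg _).trans h1
    rw [Real.norm_eq_abs] at h0 h1
    refine (abs_add_le _ _).trans (add_le_add ?_ ?_)
    · rw [abs_mul, abs_of_nonneg (by positivity)]
      gcongr
      exact hr.2
    · rw [abs_mul, abs_of_nonneg (by positivity)]
      gcongr
      exact hr.2
  have hcut : ∀ N, Continuous (cutoff N) := fun N => (contDiff_cutoff N).continuous
  have hinner : ∀ N ϑ, ∀ᵐ r ∂volume, r ∈ uIoc (1 : ℝ) 2 → ‖cutoff N (r ^ 2) * H' ϑ r‖ ≤ C :=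
    fun N ϑ => Eventually.of_forall fun r hr => by
      rw [uIoc_of_le one_le_two] at hr
      rw [norm_mul, Real.norm_eq_abs, Real.norm_eq_abs]
      exact (mul_le_of_le_one_left (abs_nonneg _) (abs_cutoff_le_one _ _)).trans
        (hbd ϑ r ⟨hr.1.le, hr.2⟩)
  refine tendsto_integral_of_dominated_convergence (fun ϑ => |f (sphParam ϑ)| + C) (fun N => ?_)
    ?_ (fun N => ?_) ?_
  · refine Continuous.aestronglyMeasurable ?_
    have h1 : Continuous fun ϑ => ∫ r in (1 : ℝ)..2, cutoff N (r ^ 2) * H' ϑ r := by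
      refine intervalIntegral.continuous_parametric_intervalIntegral_of_continuous' ?_ _ _
      simp only [Function.uncurry_def]
      have := hcut N
      fun_prop
    have h2 := hf.continuous.comp hsc
    exact (hgc.mul ((EuclideanSpace.proj (𝕜 := ℝ) i).continuous.comp hsc)).mul (h2.add h1)
  · refine Integrable.add ?_ (integrable_const _)
    refine Integrable.of_bound (C := M₀)
      (hf.continuous.comp hsc).abs.aestronglyMeasurable (Eventually.of_forall fun ϑ => ?_)
    rw [norm_abs_eq_norm]
    exact hM₀ _ (by rw [mem_closedBall_zero_iff, norm_sphParam]; norm_num)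
  · refine Eventually.of_forall fun ϑ => ?_
    have h1 := intervalIntegral.norm_integral_le_of_norm_le_const_ae (hinner N ϑ)
    have h2 : ‖gramWeight ϑ * sphParam ϑ i‖ ≤ 1 := by
      rw [norm_mul]
      refine mul_le_one₀ ?_ (norm_nonneg _) ((PiLp.norm_apply_le _ _).trans (norm_sphParam ϑ).le)
      rw [Real.norm_eq_abs, abs_of_nonneg (gramWeight_nonneg _)]
      exact gramWeight_le_one _
    rw [norm_mul]
    refine (mul_le_of_le_one_left (norm_nonneg _) h2).trans ((norm_add_le _ _).trans ?_)
    rw [Real.norm_eq_abs]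
    gcongr
    refine h1.trans_eq ?_
    norm_num
  · refine Eventually.of_forall fun ϑ => ?_
    have h0 : Tendsto (fun N => ∫ r in (1 : ℝ)..2, cutoff N (r ^ 2) * H' ϑ r) atTop
        (𝓝 (∫ r in (1 : ℝ)..2, (0 : ℝ))) := by
      refine intervalIntegral.tendsto_integral_filter_of_dominated_convergence (fun _ => C)
        (Eventually.of_forall fun N => ?_) (Eventually.of_forall fun N => hinner N ϑ)
        intervalIntegrable_const (Eventually.of_forall fun r hr => ?_)
      · have h1 : Continuous fun r => H' ϑ r := hH'c.comp (Continuous.prodMk_right ϑ)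
        have := hcut N
        exact (by fun_prop : Continuous fun r => cutoff N (r ^ 2) * H' ϑ r).aestronglyMeasurable
      · rw [uIoc_of_le one_le_two] at hr
        simpa using (tendsto_cutoff (t := r ^ 2) (by nlinarith [hr.1])).mul_const (H' ϑ r)
    rw [intervalIntegral.integral_zero] at h0
    simpa using (h0.const_add (f (sphParam ϑ))).const_mul (gramWeight ϑ * sphParam ϑ i)

end AveragedES

namespace AveragedES

open Set Filter Topology

/-! ### The averaged gradient as an integral over the torus of angles. -/

theorem integrable_angleMeasure {E : Type*} [NormedAddCommGroup E] {n : ℕ}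
    {H : (Fin n → ℝ) → E} (hH : Continuous H) : Integrable H (angleMeasure n) := by
  unfold angleMeasure
  rw [← Measure.restrict_pi_pi]
  have h : IntegrableOn H (Set.univ.pi fun _ : Fin n => Icc (-Real.pi) Real.pi)
      (Measure.pi fun _ => volume) := by
    rw [← volume_pi]
    exact hH.continuousOn.integrableOn_compact (isCompact_univ_pi fun _ => isCompact_Icc)
  exact h.mono_set (pi_mono fun _ _ => Ioc_subset_Icc_self)

variable {m : ℕ}

theorem gradient_averagedObjective_apply {J : EuclideanSpace ℝ (Fin (m + 2)) → ℝ}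
    (hJ : ContDiff ℝ 1 J) (a : ℝ) (x : EuclideanSpace ℝ (Fin (m + 2))) (i : Fin (m + 2)) :
    gradient (averagedObjective J a) x i = 1 / ballVol m *
      ∫ ξ in Metric.closedBall (0 : EuclideanSpace ℝ (Fin (m + 2))) 1,
        fderiv ℝ J (x + a • ξ) (EuclideanSpace.single i 1) := by
  have hJ' : Continuous fun x => fderiv ℝ J x := hJ.continuous_fderiv one_ne_zero
  have hc : Continuous fun q : EuclideanSpace ℝ (Fin (m + 2)) × EuclideanSpace ℝ (Fin (m + 2)) =>
    q.1 + a • q.2 := by fun_prop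
  obtain ⟨C, hC⟩ := ((isCompact_closedBall x 1).prod
    (isCompact_closedBall (0 : EuclideanSpace ℝ (Fin (m + 2))) 1)).exists_bound_of_continuousOn
    (hJ'.comp hc).continuousOn
  have hint : ∀ y, IntegrableOn (fun ξ => fderiv ℝ J (y + a • ξ)) (Metric.closedBall 0 1) :=
    fun y => (hJ'.comp (hc.comp (Continuous.prodMk_right y))).continuousOn.integrableOn_compact
      (isCompact_closedBall _ _)
  have hd : HasFDerivAt (fun y => ∫ ξ in Metric.closedBall 0 1, J (y + a • ξ))
      (∫ ξ in Metric.closedBall 0 1, fderiv ℝ J (x + a • ξ)) x := by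
    refine hasFDerivAt_integral_of_dominated_of_fderiv_le (bound := fun _ => C)
      (F' := fun y ξ => fderiv ℝ J (y + a • ξ))
      (Metric.ball_mem_nhds x one_pos) (Eventually.of_forall fun y => ?_) ?_
      (hint x).aestronglyMeasurable ?_ ?_ (Eventually.of_forall fun ξ y _ => ?_)
    · exact (hJ.continuous.comp (hc.comp (Continuous.prodMk_right y))).aestronglyMeasurable
    · exact (hJ.continuous.comp
        (hc.comp (Continuous.prodMk_right x))).continuousOn.integrableOn_compact
        (isCompact_closedBall _ _)
    · filter_upwards [ae_restrict_mem Metric.isClosed_closedBall.measurableSet] with ξ hξ y hy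
      exact hC (y, ξ) ⟨Metric.ball_subset_closedBall hy, hξ⟩
    · exact integrableOn_const (isCompact_closedBall _ _).measure_lt_top.ne
    · have h1 := (hJ.differentiable one_ne_zero (y + a • ξ)).hasFDerivAt
      exact h1.comp y ((hasFDerivAt_id y).add_const (a • ξ))
  have hd' : HasFDerivAt (averagedObjective J a)
      ((1 / ballVol m) • ∫ ξ in Metric.closedBall 0 1, fderiv ℝ J (x + a • ξ)) x :=
    hd.const_mul (1 / ballVol m)
  have h1 : gradient (averagedObjective J a) x i =
      fderiv ℝ (averagedObjective J a) x (EuclideanSpace.single i 1) := by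
    rw [gradient, ← InnerProductSpace.toDual_symm_apply, EuclideanSpace.inner_single_right]
    simp
  rw [h1, hd'.fderiv, smul_apply, ContinuousLinearMap.integral_apply (hint x),
    smul_eq_mul]

theorem ballVol_pos (m : ℕ) : 0 < ballVol m :=
  ENNReal.toReal_pos (Metric.measure_closedBall_pos _ _ one_pos).ne'
    (isCompact_closedBall _ _).measure_lt_top.ne

/-- The divergence theorem for `ξ ↦ J (x + a • ξ)`. The constant `gainConst` is chosen so that `(2π)
^ (m + 1) * gainConst m = 2 ^ m * ballVol m`. -/
theorem integral_angleMeasure_eq_gradient {J : EuclideanSpace ℝ (Fin (m + 2)) → ℝ}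
    (hJ : ContDiff ℝ 1 J) (a : ℝ) (x : EuclideanSpace ℝ (Fin (m + 2))) :
    ∫ ϑ, (J (x + a • sphParam ϑ) * gramWeight ϑ) • sphParam ϑ ∂angleMeasure (m + 1) =
      ((2 * Real.pi) ^ (m + 1) * (a * gainConst m)) • gradient (averagedObjective J a) x := by
  have hc : Continuous fun ϑ : Fin (m + 1) → ℝ =>
      (J (x + a • sphParam ϑ) * gramWeight ϑ) • sphParam ϑ :=
    ((hJ.continuous.comp (continuous_const.add (continuous_sphParam.const_smul a))).mul
      continuous_gramWeight).smul continuous_sphParam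
  ext i
  have h1 := (EuclideanSpace.proj i : EuclideanSpace ℝ (Fin (m + 2)) →L[ℝ] ℝ).integral_comp_comm
    (integrable_angleMeasure hc)
  simp only [PiLp.proj_apply, PiLp.smul_apply, smul_eq_mul] at h1
  have hf : ContDiff ℝ 1 fun ξ : EuclideanSpace ℝ (Fin (m + 2)) => J (x + a • ξ) :=
    hJ.comp (by fun_prop)
  have hfd : ∀ ξ v, fderiv ℝ (fun ξ : EuclideanSpace ℝ (Fin (m + 2)) => J (x + a • ξ)) ξ v =
      a * fderiv ℝ J (x + a • ξ) v := fun ξ v => by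
    have h2 : HasFDerivAt (fun ξ : EuclideanSpace ℝ (Fin (m + 2)) => x + a • ξ)
      (a • ContinuousLinearMap.id ℝ _) ξ := ((hasFDerivAt_id ξ).const_smul a).const_add x
    have h3 := (hJ.differentiable one_ne_zero (x + a • ξ)).hasFDerivAt.comp ξ h2
    rw [show (fun ξ : EuclideanSpace ℝ (Fin (m + 2)) => J (x + a • ξ)) =
      J ∘ fun ξ => x + a • ξ from rfl, h3.fderiv]
    simp
  have h4 := integral_closedBall_fderiv hf i
  simp only [hfd, integral_const_mul] at h4
  have hpi := Real.pi_pos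
  have hv := ballVol_pos m
  rw [← h1, PiLp.smul_apply, smul_eq_mul, gradient_averagedObjective_apply hJ]
  trans ∫ ϑ, gramWeight ϑ * sphParam ϑ i * J (x + a • sphParam ϑ) ∂angleMeasure (m + 1)
  · exact integral_congr_ae (Eventually.of_forall fun ϑ => by simp only; ring)
  · rw [← h4, gainConst, mul_pow]
    field_simp
    ring

/-! ### Equidistribution of the curve of angles -/

/-- By periodicity the integral is unchanged under time shifts `s`, so it may be averaged over `0 ≤
s ≤ 2π / N`. Undoing the shift in the slow argument costs at most `ε` pointwise, while the fast
argument then sweeps exactly one period. -/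
theorem norm_integral_fast_sub_le {E : Type*} [NormedAddCommGroup E] [NormedSpace ℝ E]
    [CompleteSpace E] {h : ℝ → ℝ → E} (hc : Continuous fun q : ℝ × ℝ => h q.1 q.2)
    (hp₂ : ∀ τ, Function.Periodic (h τ) (2 * Real.pi))
    {N : ℝ} (hN : 0 < N) (hp : Function.Periodic (fun τ => h τ (N * τ)) (2 * Real.pi)) {ε : ℝ}
    (hε : ∀ τ σ, ∀ s ∈ Icc 0 (2 * Real.pi / N), ‖h (τ + s) σ - h τ σ‖ ≤ ε) :
    ‖(∫ τ in -Real.pi..Real.pi, h τ (N * τ)) -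
      (2 * Real.pi)⁻¹ • ∫ τ in -Real.pi..Real.pi, ∫ σ in -Real.pi..Real.pi, h τ σ‖ ≤
      2 * Real.pi * ε := by
  have hpi := Real.pi_pos
  set P : ℝ := 2 * Real.pi / N with hP
  have hP0 : 0 < P := by positivity
  have hNP : N * P = 2 * Real.pi := by rw [hP]; field_simp
  have e1 : ∀ s, ∫ τ in -Real.pi..Real.pi, h (τ + s) (N * τ + N * s) =
      ∫ τ in -Real.pi..Real.pi, h τ (N * τ) := fun s => by
    simp_rw [← mul_add]
    rw [intervalIntegral.integral_comp_add_right (fun τ => h τ (N * τ))]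
    have := hp.intervalIntegral_add_eq (-Real.pi + s) (-Real.pi)
    rw [show -Real.pi + s + 2 * Real.pi = Real.pi + s by ring,
      show -Real.pi + 2 * Real.pi = Real.pi by ring] at this
    exact this
  have e2 : ∀ τ, ∫ s in (0 : ℝ)..P, h τ (N * τ + N * s) =
      N⁻¹ • ∫ σ in -Real.pi..Real.pi, h τ σ := fun τ => by
    rw [intervalIntegral.integral_comp_add_mul (fun σ => h τ σ) hN.ne', hNP, mul_zero, add_zero,
      (hp₂ τ).intervalIntegral_add_eq (N * τ) (-Real.pi),
      show -Real.pi + 2 * Real.pi = Real.pi by ring]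
  have e3 : ∫ s in (0 : ℝ)..P, ∫ τ in -Real.pi..Real.pi, h τ (N * τ + N * s) =
      N⁻¹ • ∫ τ in -Real.pi..Real.pi, ∫ σ in -Real.pi..Real.pi, h τ σ := by
    rw [← intervalIntegral.integral_smul]
    simp_rw [← e2]
    refine intervalIntegral_intervalIntegral_swap ?_
    rw [uIoc_of_le hP0.le, uIoc_of_le (by linarith)]
    have : Continuous (Function.uncurry fun s τ => h τ (N * τ + N * s)) := by
      simp only [Function.uncurry_def]
      exact hc.comp (by fun_prop : Continuous fun q : ℝ × ℝ => (q.2, N * q.2 + N * q.1))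
    refine IntegrableOn.mono_set (t := Icc 0 P ×ˢ Icc (-Real.pi) Real.pi) ?_
      (prod_mono Ioc_subset_Icc_self Ioc_subset_Icc_self)
    exact this.continuousOn.integrableOn_compact (isCompact_Icc.prod isCompact_Icc)
  have e4 : ∫ s in (0 : ℝ)..P, ∫ τ in -Real.pi..Real.pi, h (τ + s) (N * τ + N * s) =
      P • ∫ τ in -Real.pi..Real.pi, h τ (N * τ) := by
    simp_rw [e1]
    rw [intervalIntegral.integral_const, sub_zero]
  have c1 : Continuous fun q : ℝ × ℝ => h (q.2 + q.1) (N * q.2 + N * q.1) :=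
    hc.comp (by fun_prop : Continuous fun q : ℝ × ℝ => (q.2 + q.1, N * q.2 + N * q.1))
  have c2 : Continuous fun q : ℝ × ℝ => h q.2 (N * q.2 + N * q.1) :=
    hc.comp (by fun_prop : Continuous fun q : ℝ × ℝ => (q.2, N * q.2 + N * q.1))
  have c3 : Continuous fun s : ℝ => ∫ τ in -Real.pi..Real.pi, h (τ + s) (N * τ + N * s) :=
    intervalIntegral.continuous_parametric_intervalIntegral_of_continuous' c1 _ _
  have c4 : Continuous fun s : ℝ => ∫ τ in -Real.pi..Real.pi, h τ (N * τ + N * s) :=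
    intervalIntegral.continuous_parametric_intervalIntegral_of_continuous' c2 _ _
  have key : ‖(∫ s in (0 : ℝ)..P, ∫ τ in -Real.pi..Real.pi, h (τ + s) (N * τ + N * s)) -
      ∫ s in (0 : ℝ)..P, ∫ τ in -Real.pi..Real.pi, h τ (N * τ + N * s)‖ ≤
      (2 * Real.pi * ε) * |P - 0| := by
    rw [← intervalIntegral.integral_sub (c3.intervalIntegrable _ _) (c4.intervalIntegrable _ _)]
    refine intervalIntegral.norm_integral_le_of_norm_le_const fun s hs => ?_
    rw [uIoc_of_le hP0.le] at hs
    have h1 := intervalIntegral.integral_sub (μ := volume)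
      ((c1.comp (Continuous.prodMk_right s)).intervalIntegrable (-Real.pi) Real.pi)
      ((c2.comp (Continuous.prodMk_right s)).intervalIntegrable (-Real.pi) Real.pi)
    simp only [Function.comp_apply] at h1
    rw [← h1]
    refine (intervalIntegral.norm_integral_le_of_norm_le_const (C := ε) fun τ _ =>
      hε τ _ s ⟨hs.1.le, hs.2⟩).trans_eq ?_
    rw [abs_of_nonneg (by linarith)]
    ring
  rw [e3, e4, sub_zero, abs_of_pos hP0] at key
  have e5 : N⁻¹ = P * (2 * Real.pi)⁻¹ := by rw [hP]; field_simp
  rw [e5, mul_smul, ← smul_sub, norm_smul, Real.norm_eq_abs, abs_of_pos hP0, mul_comm] at key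
  exact le_of_mul_le_mul_right key hP0

theorem angles_succ (m k : ℕ) (τ : ℝ) : angles (m + 1) k τ =
    Fin.snoc (angles m k τ) ((2 : ℝ) ^ ((m + 1) * k - 1 : ℤ) * τ) := by
  ext j
  refine Fin.lastCases ?_ (fun j => ?_) j
  · rw [Fin.snoc_last]
    simp [angles]
  · rw [Fin.snoc_castSucc]
    simp [angles]

theorem angles_zero (k : ℕ) (τ : ℝ) : angles 0 k τ = fun _ => τ := by
  ext j
  have : j = 0 := Subsingleton.elim (α := Fin 1) j 0
  simp [angles, this]

theorem continuous_angles (m k : ℕ) : Continuous (angles m k) := by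
  refine continuous_pi fun j => ?_
  unfold angles
  split_ifs <;> fun_prop

theorem exists_nat_two_zpow {j k : ℕ} (hj : 0 < j) (hk : 0 < k) :
    ∃ N : ℕ, (2 : ℝ) ^ ((j : ℤ) * k - 1) = N := by
  refine ⟨2 ^ (j * k - 1), ?_⟩
  have : (j : ℤ) * k - 1 = ((j * k - 1 : ℕ) : ℤ) := by
    have := Nat.mul_pos hj hk
    push_cast [Nat.cast_sub this]
    ring
  rw [this, zpow_natCast]
  simp

theorem exists_angles_add_period (m : ℕ) {k : ℕ} (hk : 0 < k) : ∃ n : Fin (m + 1) → ℤ,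
    ∀ τ, angles m k (τ + 2 * Real.pi) = fun j => angles m k τ j + n j * (2 * Real.pi) := by
  have : ∀ j : Fin (m + 1), ∃ n : ℤ, ∀ τ,
      angles m k (τ + 2 * Real.pi) j = angles m k τ j + n * (2 * Real.pi) := fun j => by
    by_cases hj : j = 0
    · exact ⟨1, fun τ => by simp [angles, hj]⟩
    · obtain ⟨N, hN⟩ := exists_nat_two_zpow (j := j) (Nat.pos_of_ne_zero (by simpa using hj)) hk
      refine ⟨N, fun τ => ?_⟩
      simp only [angles, hj, if_false, hN]
      push_cast
      ring
  choose n hn using this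
  exact ⟨n, fun τ => funext fun j => hn j τ⟩

/-- The bound on `s` is one period of the next faster angle. The constant is `4π` rather than `2π`
because the slowest angle has frequency `1`, outside the pattern `2 ^ (j * k - 1)`. -/
theorem abs_angles_sub_le (m : ℕ) {k : ℕ} (hk : 0 < k) {τ s : ℝ} (hs : 0 ≤ s)
    (hs' : s ≤ 2 * Real.pi / (2 : ℝ) ^ ((m + 1) * k - 1 : ℤ)) (j : Fin (m + 1)) :
    |angles m k (τ + s) j - angles m k τ j| ≤ 4 * Real.pi / 2 ^ k := by
  have hpi := Real.pi_pos
  have hk' : (1 : ℤ) ≤ k := by exact_mod_cast hk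
  have key : ∀ e : ℤ, e + k ≤ (m + 1) * k → (2 : ℝ) ^ e * s ≤ 4 * Real.pi / 2 ^ k := fun e he => by
    calc (2 : ℝ) ^ e * s ≤ (2 : ℝ) ^ e * (2 * Real.pi / (2 : ℝ) ^ ((m + 1) * k - 1 : ℤ)) := by
          gcongr
      _ = 4 * Real.pi * (2 : ℝ) ^ (e - (m + 1) * k) := by
        rw [zpow_sub₀ two_ne_zero, zpow_sub₀ two_ne_zero]
        field_simp
        norm_num
      _ ≤ 4 * Real.pi * (2 : ℝ) ^ (-k : ℤ) := by
        gcongr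
        · norm_num
        · linarith
      _ = 4 * Real.pi / 2 ^ k := by rw [zpow_neg, zpow_natCast]; rfl
  by_cases hj : j = 0
  · simp only [angles, hj, if_true, add_sub_cancel_left, abs_of_nonneg hs]
    have := key 0 (by nlinarith)
    simpa using this
  · simp only [angles, hj, if_false]
    rw [← mul_sub, add_sub_cancel_left, abs_of_nonneg (by positivity)]
    refine key _ ?_
    have : ((j : ℕ) : ℤ) ≤ m := by exact_mod_cast Nat.lt_succ_iff.1 j.2
    nlinarith

/-- The fastest angle is averaged out while the others are nearly constant, and induction treats the
resulting function `H'` of one angle fewer. Its modulus of continuity is `2π` times that of `H`;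
each of the `m` steps contributes the same error. -/
theorem norm_integral_angles_sub_le {E : Type*} [NormedAddCommGroup E] [NormedSpace ℝ E]
    [CompleteSpace E] {m k : ℕ} (hk : 0 < k) {H : (Fin (m + 1) → ℝ) → E} (hH : Continuous H)
    (hp : ∀ ϑ (n : Fin (m + 1) → ℤ), H (fun j => ϑ j + n j * (2 * Real.pi)) = H ϑ) {ε : ℝ}
    (hε : ∀ ϑ ϑ', (∀ j, |ϑ j - ϑ' j| ≤ 4 * Real.pi / 2 ^ k) → ‖H ϑ - H ϑ'‖ ≤ ε) :
    ‖(2 * Real.pi) ^ m • (∫ τ in -Real.pi..Real.pi, H (angles m k τ)) -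
      ∫ ϑ, H ϑ ∂angleMeasure (m + 1)‖ ≤ m * (2 * Real.pi) ^ (m + 1) * ε := by
  have hpi := Real.pi_pos
  have hpile : -Real.pi ≤ Real.pi := by linarith
  induction m generalizing ε with
  | zero =>
    have h1 := integral_pi_snoc _ (integrable_angleMeasure hH)
    rw [Measure.pi_of_empty (α := Fin 0), integral_dirac] at h1
    have h2 : ∫ τ in -Real.pi..Real.pi, H (angles 0 k τ) = ∫ ϑ, H ϑ ∂angleMeasure (0 + 1) := by
      refine Eq.trans ?_ h1.symm
      rw [intervalIntegral.integral_of_le hpile]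
      refine integral_congr_ae (Eventually.of_forall fun τ => ?_)
      simp only [angles_zero]
      congr 1
    simp [h2]
  | succ m ih =>
    set N : ℝ := (2 : ℝ) ^ ((m + 1) * k - 1 : ℤ) with hN
    have hN0 : 0 < N := by positivity
    have hsn : Continuous fun q : (Fin (m + 1) → ℝ) × ℝ => H (Fin.snoc q.1 q.2) :=
      hH.comp (Continuous.finSnoc (A := fun _ => ℝ) continuous_fst continuous_snd)
    have hpsn : ∀ (ϑ : Fin (m + 1) → ℝ) (σ : ℝ) (n : Fin (m + 1) → ℤ) (l : ℤ),
        H (Fin.snoc (fun j => ϑ j + n j * (2 * Real.pi)) (σ + l * (2 * Real.pi))) =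
        H (Fin.snoc ϑ σ) := fun ϑ σ n l => by
      rw [← hp (Fin.snoc ϑ σ) (Fin.snoc n l)]
      congr 1
      ext j
      refine Fin.lastCases ?_ (fun j => ?_) j <;> simp
    have hesn : ∀ (ϑ ϑ' : Fin (m + 1) → ℝ) (σ : ℝ), (∀ j, |ϑ j - ϑ' j| ≤ 4 * Real.pi / 2 ^ k) →
        ‖H (Fin.snoc ϑ σ) - H (Fin.snoc ϑ' σ)‖ ≤ ε := fun ϑ ϑ' σ h => by
      refine hε _ _ fun j => ?_
      refine Fin.lastCases ?_ (fun j => ?_) j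
      · simp only [Fin.snoc_last, sub_self, abs_zero]
        positivity
      · simpa using h j
    have h1 := norm_integral_fast_sub_le (h := fun τ σ => H (Fin.snoc (angles m k τ) σ))
      (hsn.comp (((continuous_angles m k).comp continuous_fst).prodMk continuous_snd))
      (fun τ σ => by simpa using hpsn (angles m k τ) σ 0 1) hN0
      (fun τ => by
        obtain ⟨n, hn⟩ := exists_angles_add_period (m + 1) hk
        have := hp (angles (m + 1) k τ) n
        rw [← hn, angles_succ, angles_succ] at this
        exact this) (ε := ε)
      (fun τ σ s hs => hesn _ _ σ fun j => abs_angles_sub_le m hk hs.1 hs.2 j)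
    set H' : (Fin (m + 1) → ℝ) → E := fun ϑ => ∫ σ in -Real.pi..Real.pi, H (Fin.snoc ϑ σ) with hH'
    have hH'c : Continuous H' :=
      intervalIntegral.continuous_parametric_intervalIntegral_of_continuous' hsn _ _
    have h2 := ih hH'c (fun ϑ n => by
        simp only [hH']
        congr 1
        ext σ
        simpa using hpsn ϑ σ n 0) (ε := 2 * Real.pi * ε) (fun ϑ ϑ' h => by
        simp only [hH']
        have h1 := intervalIntegral.integral_sub (μ := volume)
          ((hsn.comp (Continuous.prodMk_right ϑ)).intervalIntegrable (-Real.pi) Real.pi)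
          ((hsn.comp (Continuous.prodMk_right ϑ')).intervalIntegrable (-Real.pi) Real.pi)
        simp only [Function.comp_apply] at h1
        rw [← h1]
        refine (intervalIntegral.norm_integral_le_of_norm_le_const (C := ε) fun σ _ =>
          hesn ϑ ϑ' σ h).trans_eq ?_
        rw [abs_of_nonneg (by linarith)]
        ring)
    have h3 : ∫ ϑ, H ϑ ∂angleMeasure (m + 1 + 1) = ∫ ϑ, H' ϑ ∂angleMeasure (m + 1) := by
      refine (integral_pi_snoc _ (integrable_angleMeasure hH)).trans ?_
      simp only [hH', intervalIntegral.integral_of_le hpile]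
      rfl
    simp_rw [angles_succ]
    rw [h3]
    set A := ∫ τ in -Real.pi..Real.pi, H (Fin.snoc (angles m k τ) (N * τ))
    set B := ∫ τ in -Real.pi..Real.pi, H' (angles m k τ)
    have h4 : (2 * Real.pi) ^ (m + 1) • A - ∫ ϑ, H' ϑ ∂angleMeasure (m + 1) =
        (2 * Real.pi) ^ (m + 1) • (A - (2 * Real.pi)⁻¹ • B) +
          ((2 * Real.pi) ^ m • B - ∫ ϑ, H' ϑ ∂angleMeasure (m + 1)) := by
      have : (2 * Real.pi) ^ (m + 1) * (2 * Real.pi)⁻¹ = (2 * Real.pi) ^ m := by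
        rw [pow_succ]; field_simp
      rw [smul_sub, smul_smul, this]
      abel
    rw [h4]
    refine (norm_add_le _ _).trans ?_
    rw [norm_smul, Real.norm_eq_abs, abs_of_pos (by positivity)]
    have h5 := mul_le_mul_of_nonneg_left h1 (by positivity : (0 : ℝ) ≤ (2 * Real.pi) ^ (m + 1))
    refine (add_le_add h5 h2).trans_eq ?_
    push_cast
    ring

/-- Periodicity reduces the claim to uniform continuity on a compact box. Both points are translated
by the same lattice vector, chosen for `ϑ`; the margin of the box and `r ≤ 1` accommodate `ϑ'`. -/
theorem exists_modulus_of_periodic {X E : Type*} [PseudoMetricSpace X] [NormedAddCommGroup E]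
    {n : ℕ} {Ψ : X → (Fin n → ℝ) → E} (hΨ : Continuous fun q : X × (Fin n → ℝ) => Ψ q.1 q.2)
    (hp : ∀ x ϑ (l : Fin n → ℤ), Ψ x (fun j => ϑ j + l j * (2 * Real.pi)) = Ψ x ϑ)
    {K : Set X} (hK : IsCompact K) {ε : ℝ} (hε : 0 < ε) :
    ∃ r, 0 < r ∧ ∀ x ∈ K, ∀ ϑ ϑ', (∀ j, |ϑ j - ϑ' j| ≤ r) → ‖Ψ x ϑ - Ψ x ϑ'‖ ≤ ε := by
  have hpi := Real.pi_pos
  have hcomp : IsCompact (K ×ˢ (Set.univ.pi fun _ : Fin n => Icc (-1 : ℝ) (2 * Real.pi + 1))) :=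
    hK.prod (isCompact_univ_pi fun _ => isCompact_Icc)
  obtain ⟨r, hr, h⟩ := Metric.uniformContinuousOn_iff_le.1
    (hcomp.uniformContinuousOn_of_continuous hΨ.continuousOn) ε hε
  refine ⟨min r 1, lt_min hr one_pos, fun x hx ϑ ϑ' hϑ => ?_⟩
  set l : Fin n → ℤ := fun j => -⌊ϑ j / (2 * Real.pi)⌋ with hl
  rw [← hp x ϑ l, ← hp x ϑ' l, ← dist_eq_norm]
  have h0 : ∀ j, 0 ≤ ϑ j + l j * (2 * Real.pi) ∧ ϑ j + l j * (2 * Real.pi) ≤ 2 * Real.pi :=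
    fun j => by
      have h1 := Int.floor_le (ϑ j / (2 * Real.pi))
      have h2 := (Int.lt_floor_add_one (ϑ j / (2 * Real.pi))).le
      rw [le_div_iff₀ (by positivity)] at h1
      rw [div_le_iff₀ (by positivity)] at h2
      simp only [hl]
      push_cast
      constructor <;> linarith
  refine h (x, _) ⟨hx, fun j _ => ?_⟩ (x, _) ⟨hx, fun j _ => ?_⟩ ?_
  · exact ⟨by linarith [(h0 j).1], by linarith [(h0 j).2]⟩
  · have := abs_le.1 ((hϑ j).trans (min_le_right _ _))
    exact ⟨by linarith [(h0 j).1], by linarith [(h0 j).2]⟩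
  · rw [Prod.dist_eq, max_le_iff]
    refine ⟨by simpa using hr.le, (dist_pi_le_iff hr.le).2 fun j => ?_⟩
    rw [dist_add_right, Real.dist_eq]
    exact (hϑ j).trans (min_le_left _ _)

theorem exists_forall_norm_integral_dither_sub_le {J : EuclideanSpace ℝ (Fin (m + 2)) → ℝ}
    (hJ : ContDiff ℝ 1 J) (a : ℝ) {K : Set (EuclideanSpace ℝ (Fin (m + 2)))} (hK : IsCompact K)
    {ε : ℝ} (hε : 0 < ε) :
    ∃ k₀ : ℕ, 0 < k₀ ∧ ∀ k, k₀ ≤ k → ∀ x ∈ K,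
      ‖(∫ τ in -Real.pi..Real.pi, J (x + a • ditherU m k τ) • ditherV m k τ) -
        (2 * Real.pi * (a * gainConst m)) • gradient (averagedObjective J a) x‖ ≤ ε := by
  have hpi := Real.pi_pos
  set Ψ : EuclideanSpace ℝ (Fin (m + 2)) → (Fin (m + 1) → ℝ) → EuclideanSpace ℝ (Fin (m + 2)) :=
    fun x ϑ => (J (x + a • sphParam ϑ) * gramWeight ϑ) • sphParam ϑ with hΨ
  have hΨc : Continuous fun q : EuclideanSpace ℝ (Fin (m + 2)) × (Fin (m + 1) → ℝ) => Ψ q.1 q.2 :=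
    ((hJ.continuous.comp (continuous_fst.add ((continuous_sphParam.comp
      continuous_snd).const_smul a))).mul (continuous_gramWeight.comp continuous_snd)).smul
      (continuous_sphParam.comp continuous_snd)
  have hΨp : ∀ x ϑ (l : Fin (m + 1) → ℤ), Ψ x (fun j => ϑ j + l j * (2 * Real.pi)) = Ψ x ϑ :=
    fun x ϑ l => by simp only [hΨ, sphParam_add_period, gramWeight_add_period]
  -- There are only `m` error terms; dividing by `m + 1` also covers `m = 0`.
  set ε' : ℝ := ε / ((m + 1) * (2 * Real.pi)) with hε'
  have hε'0 : 0 < ε' := by positivity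
  obtain ⟨r, hr, hmod⟩ := exists_modulus_of_periodic hΨc hΨp hK hε'0
  have hlim : Tendsto (fun k : ℕ => 4 * Real.pi / 2 ^ k) atTop (𝓝 0) := by
    have := (tendsto_pow_atTop_nhds_zero_of_lt_one (r := (1 / 2 : ℝ)) (by norm_num)
      (by norm_num)).const_mul (4 * Real.pi)
    simpa [div_eq_mul_inv] using this
  obtain ⟨k₁, hk₁⟩ := eventually_atTop.1 (hlim.eventually_le_const hr)
  refine ⟨k₁ + 1, Nat.succ_pos _, fun k hk x hx => ?_⟩
  have hk0 : 0 < k := by omega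
  have h1 := norm_integral_angles_sub_le hk0 (hΨc.comp (Continuous.prodMk_right x))
    (fun ϑ n => hΨp x ϑ n) (ε := ε') (fun ϑ ϑ' h => hmod x hx ϑ ϑ' fun j =>
      (h j).trans (hk₁ k (by omega)))
  have h2 := integral_angleMeasure_eq_gradient hJ a x
  simp only [Function.comp_def, hΨ] at h1
  rw [h2] at h1
  have h3 : ∀ τ, (J (x + a • sphParam (angles m k τ)) * gramWeight (angles m k τ)) •
      sphParam (angles m k τ) = J (x + a • ditherU m k τ) • ditherV m k τ := fun τ => by
    rw [ditherV, ditherU, smul_smul]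
  simp only [h3] at h1
  rw [pow_succ (2 * Real.pi) m, mul_assoc, mul_smul, ← smul_sub, norm_smul, Real.norm_eq_abs,
    abs_of_pos (by positivity)] at h1
  have h4 : (2 * Real.pi) ^ m * ‖(∫ τ in -Real.pi..Real.pi, J (x + a • ditherU m k τ) •
      ditherV m k τ) - (2 * Real.pi * (a * gainConst m)) • gradient (averagedObjective J a) x‖ ≤
      (2 * Real.pi) ^ m * ε := by
    refine h1.trans ?_
    rw [hε']
    have : (m : ℝ) * ((2 * Real.pi) ^ m * (2 * Real.pi)) * (ε / ((m + 1) * (2 * Real.pi))) =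
      (2 * Real.pi) ^ m * (ε * (m / (m + 1))) := by field_simp
    rw [this]
    gcongr
    refine mul_le_of_le_one_right hε.le ?_
    rw [div_le_one (by positivity)]
    linarith
  exact le_of_mul_le_mul_left h4 (by positivity)

end AveragedES

namespace AveragedES

open Set Filter Topology

/-! ### Auxiliary facts on integrals and continuous functions on intervals -/

/-- Full periods are peeled off at the right end; the incomplete one left over costs at most `P *
M`. -/
theorem norm_integral_le_of_period {E : Type*} [NormedAddCommGroup E] [NormedSpace ℝ E]
    {f : ℝ → E} {t₀ t₁ P M κ : ℝ} (hP : 0 < P) (hM : 0 ≤ M) (hκ : 0 ≤ κ)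
    (hf : IntervalIntegrable f volume t₀ t₁) (hfM : ∀ t ∈ Icc t₀ t₁, ‖f t‖ ≤ M)
    (hper : ∀ s, t₀ ≤ s → s + P ≤ t₁ → ‖∫ r in s..s + P, f r‖ ≤ P * κ) :
    ∀ t ∈ Icc t₀ t₁, ‖∫ r in t₀..t, f r‖ ≤ (t - t₀) * κ + P * M := by
  have key : ∀ n : ℕ, ∀ t ∈ Icc t₀ t₁, t - t₀ ≤ n * P →
      ‖∫ r in t₀..t, f r‖ ≤ (t - t₀) * κ + P * M := by
    have hshort : ∀ t ∈ Icc t₀ t₁, t - t₀ ≤ P →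
        ‖∫ r in t₀..t, f r‖ ≤ (t - t₀) * κ + P * M := fun t ht h => by
      have h1 : ‖∫ r in t₀..t, f r‖ ≤ M * |t - t₀| :=
        intervalIntegral.norm_integral_le_of_norm_le_const fun r hr => by
          rw [uIoc_of_le ht.1] at hr
          exact hfM r ⟨hr.1.le, hr.2.trans ht.2⟩
      rw [abs_of_nonneg (sub_nonneg.2 ht.1)] at h1
      have h2 : M * (t - t₀) ≤ P * M := by rw [mul_comm]; gcongr
      have h3 : 0 ≤ (t - t₀) * κ := mul_nonneg (sub_nonneg.2 ht.1) hκ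
      linarith
    intro n
    induction n with
    | zero =>
      intro t ht h
      exact hshort t ht (by simp at h; linarith)
    | succ n ih =>
      intro t ht h
      by_cases hle : t - t₀ ≤ P
      · exact hshort t ht hle
      · push Not at hle
        have ht' : t - P ∈ Icc t₀ t₁ := ⟨by linarith, by linarith [ht.2]⟩
        have h1 := ih (t - P) ht' (by push_cast at h; linarith)
        have h2 := hper (t - P) ht'.1 (by linarith [ht.2])
        rw [sub_add_cancel] at h2
        have hsub : ∀ {u v}, u ∈ Icc t₀ t₁ → v ∈ Icc t₀ t₁ → IntervalIntegrable f volume u v :=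
          fun hu hv => hf.mono_set (uIcc_subset_uIcc (Icc_subset_uIcc hu) (Icc_subset_uIcc hv))
        have ht₀ : t₀ ∈ Icc t₀ t₁ := ⟨le_rfl, ht.1.trans ht.2⟩
        rw [← intervalIntegral.integral_add_adjacent_intervals (hsub ht₀ ht') (hsub ht' ht)]
        refine (norm_add_le _ _).trans ?_
        linarith
  intro t ht
  obtain ⟨n, hn⟩ := exists_nat_ge ((t - t₀) / P)
  exact key n t ht ((div_le_iff₀ hP).1 hn)

/-- A function with integrable derivative `w` that is nonpositive above the level `ρ` cannot cross
this level. -/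
theorem le_of_integral_barrier {η w : ℝ → ℝ} {t₀ t₁ ρ : ℝ} (hη : ContinuousOn η (Icc t₀ t₁))
    (hw : IntervalIntegrable w volume t₀ t₁)
    (hηw : ∀ t ∈ Icc t₀ t₁, η t = η t₀ + ∫ s in t₀..t, w s) (h0 : η t₀ ≤ ρ)
    (hbar : ∀ᵐ s, s ∈ Icc t₀ t₁ → ρ < η s → w s ≤ 0) :
    ∀ t ∈ Icc t₀ t₁, η t ≤ ρ := by
  intro t ht
  by_contra! hlt
  have ht₀ : t₀ ∈ Icc t₀ t₁ := ⟨le_rfl, ht.1.trans ht.2⟩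
  have hsubt : Icc t₀ t ⊆ Icc t₀ t₁ := Icc_subset_Icc_right ht.2
  have hS : IsCompact (Icc t₀ t ∩ η ⁻¹' Iic ρ) :=
    isCompact_Icc.of_isClosed_subset
      ((hη.mono hsubt).preimage_isClosed_of_isClosed isClosed_Icc isClosed_Iic) inter_subset_left
  obtain ⟨r, hr, hmax⟩ := hS.exists_isGreatest ⟨t₀, ⟨le_rfl, ht.1⟩, h0⟩
  have hr1 : r ∈ Icc t₀ t₁ := hsubt hr.1
  have hsub : ∀ {u v}, u ∈ Icc t₀ t₁ → v ∈ Icc t₀ t₁ → IntervalIntegrable w volume u v :=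
    fun hu hv => hw.mono_set (uIcc_subset_uIcc (Icc_subset_uIcc hu) (Icc_subset_uIcc hv))
  have h1 : η t = η r + ∫ s in r..t, w s := by
    rw [hηw t ht, hηw r hr1, ← intervalIntegral.integral_add_adjacent_intervals (hsub ht₀ hr1)
      (hsub hr1 ht)]
    ring
  have h2 : ∫ s in r..t, w s ≤ 0 := by
    rw [intervalIntegral.integral_of_le hr.1.2]
    refine integral_nonpos_of_ae ?_
    filter_upwards [ae_restrict_mem measurableSet_Ioc, ae_restrict_of_ae hbar] with s hs hs'
    have hs1 : s ∈ Icc t₀ t := ⟨hr.1.1.trans hs.1.le, hs.2⟩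
    refine hs' (hsubt hs1) ?_
    by_contra! hle
    exact absurd (hmax ⟨hs1, hle⟩) (not_le.2 hs.1)
  have h3 : η r ≤ ρ := hr.2
  linarith

theorem le_half_of_bootstrap {u : ℝ → ℝ} {t₀ t₁ ε : ℝ} (hε : 0 < ε)
    (hu : ContinuousOn u (Icc t₀ t₁)) (h0 : u t₀ ≤ 0)
    (hstep : ∀ t ∈ Icc t₀ t₁, (∀ s ∈ Icc t₀ t, u s ≤ ε) → u t ≤ ε / 2) :
    ∀ t ∈ Icc t₀ t₁, u t ≤ ε / 2 := by
  intro t ht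
  by_contra! hlt
  -- At the first time the level `c` is reached, `u ≤ ε` still holds on the past, so `hstep` gives
  -- `u ≤ ε / 2 < c`, a contradiction.
  set c := min (u t) ε with hc
  have hc2 : ε / 2 < c := lt_min hlt (by linarith)
  have hS : IsCompact (Icc t₀ t₁ ∩ u ⁻¹' Ici c) :=
    isCompact_Icc.of_isClosed_subset
      (hu.preimage_isClosed_of_isClosed isClosed_Icc isClosed_Ici) inter_subset_left
  obtain ⟨r, hr, hmin⟩ := hS.exists_isLeast ⟨t, ht, min_le_left (u t) ε⟩
  have hsub : Icc t₀ r ⊆ Icc t₀ t₁ := Icc_subset_Icc_right hr.1.2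
  have hrc : u r = c := by
    obtain ⟨s, hs, hsc⟩ := intermediate_value_Icc hr.1.1 (hu.mono hsub)
      (⟨by linarith, hr.2⟩ : c ∈ Icc (u t₀) (u r))
    have : r ≤ s := hmin ⟨hsub hs, hsc.ge⟩
    rw [le_antisymm hs.2 this] at hsc
    exact hsc
  have := hstep r hr.1 fun s hs => by
    by_contra! hlt'
    have h1 : r ≤ s := hmin ⟨hsub hs, (min_le_right _ _).trans hlt'.le⟩
    rw [le_antisymm hs.2 h1, hrc] at hlt'
    exact absurd (min_le_right (u t) ε) (not_le.2 hlt')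
  linarith

theorem IsSolution.fst {E F : Type*} [NormedAddCommGroup E] [NormedSpace ℝ E] [CompleteSpace E]
    [NormedAddCommGroup F] [NormedSpace ℝ F] [CompleteSpace F] {f : ℝ → E × F → E × F} {t₀ : ℝ}
    {z₀ : E × F} {I : Set ℝ} {z : ℝ → E × F} (hz : IsSolution f t₀ z₀ I z) {t : ℝ} (ht : t ∈ I) :
    IntervalIntegrable (fun s => (f s (z s)).1) volume t₀ t ∧
      (z t).1 = z₀.1 + ∫ s in t₀..t, (f s (z s)).1 := by
  obtain ⟨h1, h2⟩ := hz.2.2 t ht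
  refine ⟨⟨h1.1.fst, h1.2.fst⟩, ?_⟩
  rw [h2, Prod.fst_add]
  congr 1
  exact ((ContinuousLinearMap.fst ℝ E F).intervalIntegral_comp_comm h1).symm

theorem IsSolution.snd {E F : Type*} [NormedAddCommGroup E] [NormedSpace ℝ E] [CompleteSpace E]
    [NormedAddCommGroup F] [NormedSpace ℝ F] [CompleteSpace F] {f : ℝ → E × F → E × F} {t₀ : ℝ}
    {z₀ : E × F} {I : Set ℝ} {z : ℝ → E × F} (hz : IsSolution f t₀ z₀ I z) {t : ℝ} (ht : t ∈ I) :
    IntervalIntegrable (fun s => (f s (z s)).2) volume t₀ t ∧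
      (z t).2 = z₀.2 + ∫ s in t₀..t, (f s (z s)).2 := by
  obtain ⟨h1, h2⟩ := hz.2.2 t ht
  refine ⟨⟨h1.1.snd, h1.2.snd⟩, ?_⟩
  rw [h2, Prod.snd_add]
  congr 1
  exact ((ContinuousLinearMap.snd ℝ E F).intervalIntegral_comp_comm h1).symm

theorem exists_lipschitz_closedBall {E : Type*} [NormedAddCommGroup E] [NormedSpace ℝ E]
    [ProperSpace E] {J : E → ℝ} (hJ : ContDiff ℝ 1 J) (R : ℝ) :
    ∃ L, 0 ≤ L ∧ ∀ x y, ‖x‖ ≤ R → ‖y‖ ≤ R → |J x - J y| ≤ L * ‖x - y‖ := by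
  obtain ⟨C, hC⟩ := (isCompact_closedBall (0 : E) R).exists_bound_of_continuousOn
    (hJ.continuous_fderiv one_ne_zero).continuousOn
  refine ⟨max C 0, le_max_right _ _, fun x y hx hy => ?_⟩
  rw [← Real.norm_eq_abs]
  refine (convex_closedBall (0 : E) R).norm_image_sub_le_of_norm_fderiv_le
    (fun z _ => hJ.differentiable one_ne_zero z) (fun z hz => (hC z hz).trans (le_max_left _ _))
    ?_ ?_ <;> simpa

/-! ### The dither signals and the closed loop -/

variable {m : ℕ}

theorem norm_ditherU (k : ℕ) (τ : ℝ) : ‖ditherU m k τ‖ = 1 := norm_sphParam _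

theorem norm_ditherV_le (k : ℕ) (τ : ℝ) : ‖ditherV m k τ‖ ≤ 1 := by
  rw [ditherV, norm_smul, norm_ditherU, mul_one, Real.norm_eq_abs,
    abs_of_nonneg (gramWeight_nonneg _)]
  exact gramWeight_le_one _

theorem continuous_ditherU (k : ℕ) : Continuous (ditherU m k) :=
  continuous_sphParam.comp (continuous_angles m k)

theorem continuous_ditherV (k : ℕ) : Continuous (ditherV m k) :=
  (continuous_gramWeight.comp (continuous_angles m k)).smul (continuous_ditherU k)

theorem periodic_ditherU {k : ℕ} (hk : 0 < k) :
    Function.Periodic (ditherU m k) (2 * Real.pi) := fun τ => by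
  obtain ⟨n, hn⟩ := exists_angles_add_period m hk
  rw [ditherU, hn, sphParam_add_period, ditherU]

theorem periodic_ditherV {k : ℕ} (hk : 0 < k) :
    Function.Periodic (ditherV m k) (2 * Real.pi) := fun τ => by
  obtain ⟨n, hn⟩ := exists_angles_add_period m hk
  rw [ditherV, periodic_ditherU hk, hn, gramWeight_add_period, ditherV]

theorem ae_abs_le_of_eLpNorm_le {d : ℝ → ℝ} {δ : ℝ} (hδ : 0 ≤ δ)
    (hd : eLpNorm d ∞ volume ≤ ENNReal.ofReal δ) : ∀ᵐ t, |d t| ≤ δ := by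
  rw [eLpNorm_exponent_top] at hd
  filter_upwards [ae_le_eLpNormEssSup (f := d) (μ := volume)] with t ht
  have := ht.trans hd
  rwa [← ofReal_norm, ENNReal.ofReal_le_ofReal_iff hδ, Real.norm_eq_abs] at this

theorem intervalIntegrable_of_memLp_top {d : ℝ → ℝ} (hd : MemLp d ∞ volume) (s t : ℝ) :
    IntervalIntegrable d volume s t := by
  rw [intervalIntegrable_iff]
  have : IsFiniteMeasure (volume.restrict (uIoc s t)) := ⟨by simp [uIoc]⟩
  exact (hd.restrict (uIoc s t)).integrable le_top

theorem closedLoopField_eq (J : EuclideanSpace ℝ (Fin (m + 2)) → ℝ) (a b h ω : ℝ) (k : ℕ)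
    (d : ℝ → ℝ) (t : ℝ) (z : EuclideanSpace ℝ (Fin (m + 2)) × ℝ) :
    closedLoopField J a b h ω k d t z =
      ((b * (J (z.1 + a • ditherU m k (ω * t)) - z.2 + d t)) • ditherV m k (ω * t),
        h * (J (z.1 + a • ditherU m k (ω * t)) - z.2 + d t)) := by
  unfold closedLoopField
  refine Prod.ext ?_ ?_
  · simp only
    module
  · simp only
    ring

/-- The gradient of the averaged objective, scaled by the gain of the averaged closed loop. -/
noncomputable def averagedField (J : EuclideanSpace ℝ (Fin (m + 2)) → ℝ) (a : ℝ)
    (x : EuclideanSpace ℝ (Fin (m + 2))) : EuclideanSpace ℝ (Fin (m + 2)) :=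
  (a * gainConst m) • gradient (averagedObjective J a) x

theorem reducedField_eq (J : EuclideanSpace ℝ (Fin (m + 2)) → ℝ) (a b ω : ℝ) (k : ℕ)
    (d : ℝ → ℝ) (t : ℝ) (x : EuclideanSpace ℝ (Fin (m + 2))) :
    reducedField J a b ω k d t x =
      b • averagedField J a x + (b * d t) • ditherV m k (ω * t) := by
  unfold reducedField averagedField
  rw [smul_smul]
  congr 2
  ring

theorem norm_prodMk_smul_sub_le {E : Type*} [NormedAddCommGroup E] [NormedSpace ℝ E]
    {b h y y' C : ℝ} {v : E} (hv : ‖v‖ ≤ 1) (hy : |y - y'| ≤ C) :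
    ‖(((b * y) • v, h * y) : E × ℝ) - ((b * y') • v, h * y')‖ ≤ (|b| + |h|) * C := by
  have hC := (abs_nonneg _).trans hy
  rw [Prod.mk_sub_mk, Prod.norm_mk, ← sub_smul, ← mul_sub, ← mul_sub, norm_smul, norm_mul, norm_mul]
  simp only [Real.norm_eq_abs]
  have hb := abs_nonneg b
  have hh := abs_nonneg h
  refine max_le ?_ ?_
  · calc |b| * |y - y'| * ‖v‖ ≤ |b| * C * 1 := by gcongr
      _ ≤ (|b| + |h|) * C := by nlinarith
  · calc |h| * |y - y'| ≤ |h| * C := by gcongr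
      _ ≤ (|b| + |h|) * C := by nlinarith

/-- The constant is uniform in time because `d` cancels in the difference and the dither signals are
bounded. -/
theorem lipschitzOnBounded_closedLoopField {J : EuclideanSpace ℝ (Fin (m + 2)) → ℝ}
    (hJ : ContDiff ℝ 1 J) (a b h ω : ℝ) (k : ℕ) (d : ℝ → ℝ) :
    LipschitzOnBounded (closedLoopField J a b h ω k d) := by
  intro R
  obtain ⟨L, hL, hLip⟩ := exists_lipschitz_closedBall hJ (R + |a|)
  refine ⟨(|b| + |h|) * (L + 1), by positivity, fun s x y hx hy => ?_⟩
  rw [closedLoopField_eq, closedLoopField_eq, mul_assoc]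
  refine norm_prodMk_smul_sub_le (norm_ditherV_le _ _) ?_
  have hU : ∀ z : EuclideanSpace ℝ (Fin (m + 2)) × ℝ, ‖z‖ ≤ R →
      ‖z.1 + a • ditherU m k (ω * s)‖ ≤ R + |a| := fun z hz => by
    refine (norm_add_le _ _).trans (add_le_add ((norm_fst_le z).trans hz) ?_)
    rw [norm_smul, norm_ditherU, mul_one, Real.norm_eq_abs]
  have h1 := hLip _ _ (hU x hx) (hU y hy)
  rw [add_sub_add_right_eq_sub] at h1
  have h2 : |x.2 - y.2| ≤ ‖x - y‖ := norm_snd_le (x - y)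
  have h3 : ‖x.1 - y.1‖ ≤ ‖x - y‖ := norm_fst_le (x - y)
  calc _ = |(J (x.1 + a • ditherU m k (ω * s)) - J (y.1 + a • ditherU m k (ω * s))) -
        (x.2 - y.2)| := by congr 1; ring
    _ ≤ L * ‖x.1 - y.1‖ + |x.2 - y.2| := (abs_sub _ _).trans (by gcongr)
    _ ≤ L * ‖x - y‖ + ‖x - y‖ := by gcongr
    _ = (L + 1) * ‖x - y‖ := by ring

/-- There is a solution of the closed loop with saturated nonlinearities on a whole interval. -/
theorem exists_isSolution_saturated {J : EuclideanSpace ℝ (Fin (m + 2)) → ℝ}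
    (hJ : ContDiff ℝ 1 J) (hJs : HasCompactSupport J) {a b h ω ρ : ℝ} (hρ : 0 ≤ ρ) (k : ℕ)
    {d : ℝ → ℝ} (hd : MemLp d ∞ volume) {t₀ t₁ : ℝ} (ht : t₀ ≤ t₁)
    (z₀ : EuclideanSpace ℝ (Fin (m + 2)) × ℝ) :
    ∃ z, IsSolution (fun t z => closedLoopField J a b h ω k d t (z.1, max (-ρ) (min ρ z.2)))
      t₀ z₀ (Icc t₀ t₁) z := by
  obtain ⟨L, hL⟩ := hJ.lipschitzWith_of_hasCompactSupport hJs one_ne_zero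
  obtain ⟨M, hM⟩ := hJs.exists_bound_of_continuous hJ.continuous
  set sat : ℝ → ℝ := fun y => max (-ρ) (min ρ y) with hsat
  have hsatL : LipschitzWith 1 sat := (LipschitzWith.id.const_min ρ).const_max (-ρ)
  have hsatB : ∀ y, |sat y| ≤ ρ := fun y =>
    abs_le.2 ⟨le_max_left _ _, max_le (by linarith) (min_le_left _ _)⟩
  have hU := continuous_ditherU (m := m) k
  have hV := continuous_ditherV (m := m) k
  set y : ℝ → EuclideanSpace ℝ (Fin (m + 2)) × ℝ → ℝ := fun t z =>
    J (z.1 + a • ditherU m k (ω * t)) - sat z.2 with hy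
  have hyc : Continuous fun q : ℝ × EuclideanSpace ℝ (Fin (m + 2)) × ℝ => y q.1 q.2 := by
    have h1 : Continuous fun q : ℝ × EuclideanSpace ℝ (Fin (m + 2)) × ℝ =>
        q.2.1 + a • ditherU m k (ω * q.1) :=
      (by fun_prop : Continuous fun q : ℝ × EuclideanSpace ℝ (Fin (m + 2)) × ℝ => q.2.1).add
        ((hU.comp (by fun_prop : Continuous fun q : ℝ × EuclideanSpace ℝ (Fin (m + 2)) × ℝ =>
          ω * q.1)).const_smul a)
    exact (hJ.continuous.comp h1).sub (hsatL.continuous.comp (by fun_prop))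
  have hVc : Continuous fun q : ℝ × EuclideanSpace ℝ (Fin (m + 2)) × ℝ => ditherV m k (ω * q.1) :=
    hV.comp (by fun_prop)
  have hpint : ∀ s t, IntervalIntegrable
      (fun t => ((b * d t) • ditherV m k (ω * t), h * d t)) volume s t := fun s t => by
    have h1 := (intervalIntegrable_of_memLp_top hd s t).const_mul b
    have h2 := (intervalIntegrable_of_memLp_top hd s t).const_mul h
    have h3 : IntervalIntegrable (fun t => (b * d t) • ditherV m k (ω * t)) volume s t :=
      h1.smul_continuousOn (hV.comp (continuous_const.mul continuous_id)).continuousOn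
    exact ⟨h3.1.prodMk h2.1, h3.2.prodMk h2.2⟩
  obtain ⟨z, hz⟩ := exists_isSolution_add (K := .mk ((|b| + |h|) * (L + 1)) (by positivity))
    (M := (|b| + |h|) * (M + ρ)) (g := fun t z => ((b * y t z) • ditherV m k (ω * t), h * y t z))
    (p := fun t => ((b * d t) • ditherV m k (ω * t), h * d t))
    (((continuous_const.mul hyc).smul hVc).prodMk (continuous_const.mul hyc))
    (fun t => LipschitzWith.of_dist_le_mul fun z w => by
      rw [dist_eq_norm, dist_eq_norm, NNReal.coe_mk, mul_assoc]
      refine norm_prodMk_smul_sub_le (norm_ditherV_le _ _) ?_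
      have h1 := hL.dist_le_mul (z.1 + a • ditherU m k (ω * t)) (w.1 + a • ditherU m k (ω * t))
      have h2 := hsatL.dist_le_mul z.2 w.2
      rw [dist_add_right, dist_eq_norm, dist_eq_norm, Real.norm_eq_abs] at h1
      rw [Real.dist_eq, Real.dist_eq, NNReal.coe_one, one_mul] at h2
      have h3 : |z.2 - w.2| ≤ ‖z - w‖ := norm_snd_le (z - w)
      have h4 : ‖z.1 - w.1‖ ≤ ‖z - w‖ := norm_fst_le (z - w)
      calc |y t z - y t w| = |(J (z.1 + a • ditherU m k (ω * t)) -
            J (w.1 + a • ditherU m k (ω * t))) - (sat z.2 - sat w.2)| := by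
              simp only [hy]; congr 1; ring
        _ ≤ L * ‖z.1 - w.1‖ + |z.2 - w.2| := (abs_sub _ _).trans (by gcongr)
        _ ≤ L * ‖z - w‖ + ‖z - w‖ := by gcongr
        _ = (L + 1) * ‖z - w‖ := by ring)
    (fun t z => by
      have h1 := norm_prodMk_smul_sub_le (b := b) (h := h) (y := y t z) (y' := 0) (C := M + ρ)
        (norm_ditherV_le (m := m) k (ω * t)) (by
          rw [sub_zero]
          exact (abs_sub _ _).trans (add_le_add (hM _) (hsatB _)))
      simpa using h1)
    hpint ht z₀
  refine ⟨z, ?_⟩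
  convert hz using 2
  ext1 w
  rw [closedLoopField_eq, Prod.mk_add_mk, ← add_smul, ← mul_add, ← mul_add]

end AveragedES

namespace AveragedES

open Set Filter Topology

/-! ### Averaging -/

variable {m : ℕ}

theorem angleMeasure_real_univ (n : ℕ) : (angleMeasure n).real univ = (2 * Real.pi) ^ n := by
  have hpi := Real.pi_pos
  have : Real.pi - -Real.pi = 2 * Real.pi := by ring
  rw [angleMeasure, Measure.real, Measure.pi_univ]
  simp [this, ENNReal.toReal_ofReal hpi.le]

/-- Since `gramWeight` and `sphParam` have norm at most one, this average lets bounds on `J` and on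
its increments pass to the averaged field with the same constant and without second derivatives. -/
theorem averagedField_eq {J : EuclideanSpace ℝ (Fin (m + 2)) → ℝ} (hJ : ContDiff ℝ 1 J) (a : ℝ)
    (x : EuclideanSpace ℝ (Fin (m + 2))) :
    averagedField J a x = ((2 * Real.pi) ^ (m + 1))⁻¹ •
      ∫ ϑ, (J (x + a • sphParam ϑ) * gramWeight ϑ) • sphParam ϑ ∂angleMeasure (m + 1) := by
  have hpi := Real.pi_pos
  rw [integral_angleMeasure_eq_gradient hJ, smul_smul, ← mul_assoc, inv_mul_cancel₀ (by positivity),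
    one_mul, averagedField]

theorem norm_inv_smul_integral_angleMeasure_le {g : (Fin (m + 1) → ℝ) → ℝ} {C : ℝ}
    (hg : ∀ ϑ, |g ϑ| ≤ C) :
    ‖((2 * Real.pi) ^ (m + 1))⁻¹ • ∫ ϑ, (g ϑ * gramWeight ϑ) • sphParam ϑ
      ∂angleMeasure (m + 1)‖ ≤ C := by
  have hpi := Real.pi_pos
  have h1 := norm_integral_le_of_norm_le_const (μ := angleMeasure (m + 1))
    (f := fun ϑ => (g ϑ * gramWeight ϑ) • sphParam ϑ) (C := C) (Eventually.of_forall fun ϑ => by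
      rw [norm_smul, norm_sphParam, mul_one, norm_mul, Real.norm_eq_abs, Real.norm_eq_abs,
        abs_of_nonneg (gramWeight_nonneg ϑ)]
      exact (mul_le_of_le_one_right (abs_nonneg _) (gramWeight_le_one ϑ)).trans (hg ϑ))
  rw [angleMeasure_real_univ] at h1
  rw [norm_smul, norm_inv, Real.norm_eq_abs, abs_of_pos (by positivity),
    inv_mul_le_iff₀ (by positivity)]
  linarith

theorem norm_averagedField_le {J : EuclideanSpace ℝ (Fin (m + 2)) → ℝ} (hJ : ContDiff ℝ 1 J)
    {a C : ℝ} {x : EuclideanSpace ℝ (Fin (m + 2))} (hC : ∀ s, ‖s‖ = 1 → |J (x + a • s)| ≤ C) :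
    ‖averagedField J a x‖ ≤ C := by
  rw [averagedField_eq hJ]
  exact norm_inv_smul_integral_angleMeasure_le fun ϑ => hC _ (norm_sphParam ϑ)

theorem norm_averagedField_sub_le {J : EuclideanSpace ℝ (Fin (m + 2)) → ℝ} (hJ : ContDiff ℝ 1 J)
    {a C : ℝ} {x y : EuclideanSpace ℝ (Fin (m + 2))}
    (hC : ∀ s, ‖s‖ = 1 → |J (x + a • s) - J (y + a • s)| ≤ C) :
    ‖averagedField J a x - averagedField J a y‖ ≤ C := by
  have hc : ∀ x : EuclideanSpace ℝ (Fin (m + 2)), Integrable (fun ϑ : Fin (m + 1) → ℝ =>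
      (J (x + a • sphParam ϑ) * gramWeight ϑ) • sphParam ϑ) (angleMeasure (m + 1)) := fun x =>
    integrable_angleMeasure
      (((hJ.continuous.comp (continuous_const.add (continuous_sphParam.const_smul a))).mul
        continuous_gramWeight).smul continuous_sphParam)
  rw [averagedField_eq hJ, averagedField_eq hJ, ← smul_sub, ← integral_sub (hc x) (hc y)]
  simp_rw [← sub_smul, ← sub_mul]
  exact norm_inv_smul_integral_angleMeasure_le fun ϑ => hC _ (norm_sphParam ϑ)

theorem exists_forall_norm_integral_ditherV_le (m : ℕ) {ε : ℝ} (hε : 0 < ε) :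
    ∃ k₀ : ℕ, 0 < k₀ ∧ ∀ k, k₀ ≤ k → ‖∫ τ in -Real.pi..Real.pi, ditherV m k τ‖ ≤ ε := by
  -- For `J = 1` and `a = 0` the averaged term vanishes, leaving the mean of `v_k` alone.
  obtain ⟨k₀, hk₀, h⟩ := exists_forall_norm_integral_dither_sub_le (m := m) (J := fun _ => 1)
    contDiff_const 0 (isCompact_singleton (x := 0)) hε
  refine ⟨k₀, hk₀, fun k hk => ?_⟩
  have h1 := h k hk 0 rfl
  simpa using h1

theorem integral_period_comp_mul {E : Type*} [NormedAddCommGroup E] [NormedSpace ℝ E]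
    {W : ℝ → E} (hW : Function.Periodic W (2 * Real.pi)) {ω : ℝ} (hω : 0 < ω) (s : ℝ) :
    ∫ r in s..s + 2 * Real.pi / ω, W (ω * r) = ω⁻¹ • ∫ τ in -Real.pi..Real.pi, W τ := by
  rw [intervalIntegral.integral_comp_mul_left W hω.ne', mul_add, mul_div_cancel₀ _ hω.ne',
    hW.intervalIntegral_add_eq (ω * s) (-Real.pi), show -Real.pi + 2 * Real.pi = Real.pi by ring]

/-- The integrand is compared with `W`, in which the state is frozen at `s`. `W` is exactly
periodic, with integral controlled by `hA` and `hB`; the factor `2 * L` counts the drift of `J` once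
directly and once through `averagedField`. -/
theorem norm_integral_period_le {J : EuclideanSpace ℝ (Fin (m + 2)) → ℝ} (hJ : ContDiff ℝ 1 J)
    {a b ω κ ρ R L eₓ eη s : ℝ} (ha : 0 ≤ a) (hb : 0 ≤ b) (hω : 0 < ω) {k : ℕ}
    (hk : 0 < k)
    (hL : ∀ x y, ‖x‖ ≤ R + a → ‖y‖ ≤ R + a → |J x - J y| ≤ L * ‖x - y‖) (hL0 : 0 ≤ L)
    {x : ℝ → EuclideanSpace ℝ (Fin (m + 2))} {η : ℝ → ℝ}
    (hxR : ∀ r ∈ Icc s (s + 2 * Real.pi / ω), ‖x r‖ ≤ R)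
    (hx : ∀ r ∈ Icc s (s + 2 * Real.pi / ω), ‖x r - x s‖ ≤ eₓ)
    (hη : ∀ r ∈ Icc s (s + 2 * Real.pi / ω), |η r - η s| ≤ eη) (hηρ : |η s| ≤ ρ)
    (hA : ‖(∫ τ in -Real.pi..Real.pi, J (x s + a • ditherU m k τ) • ditherV m k τ) -
      (2 * Real.pi) • averagedField J a (x s)‖ ≤ κ)
    (hB : ‖∫ τ in -Real.pi..Real.pi, ditherV m k τ‖ ≤ κ)
    (hint : IntervalIntegrable (fun r => (b * (J (x r + a • ditherU m k (ω * r)) - η r)) •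
      ditherV m k (ω * r) - b • averagedField J a (x r)) volume s (s + 2 * Real.pi / ω)) :
    ‖∫ r in s..s + 2 * Real.pi / ω, ((b * (J (x r + a • ditherU m k (ω * r)) - η r)) •
      ditherV m k (ω * r) - b • averagedField J a (x r))‖ ≤
      2 * Real.pi / ω * (b * (2 * L * eₓ + eη) + b * (1 + ρ) * κ) := by
  have hpi := Real.pi_pos
  have hP : 0 < 2 * Real.pi / ω := by positivity
  have hs : s ∈ Icc s (s + 2 * Real.pi / ω) := ⟨le_rfl, by linarith⟩
  have hUc := continuous_ditherU (m := m) k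
  have hVc := continuous_ditherV (m := m) k
  set D := averagedField J a (x s) with hD
  set W : ℝ → EuclideanSpace ℝ (Fin (m + 2)) := fun τ =>
    (b * (J (x s + a • ditherU m k τ) - η s)) • ditherV m k τ - b • D with hW
  have hJU : Continuous fun τ => J (x s + a • ditherU m k τ) :=
    hJ.continuous.comp (continuous_const.add (hUc.const_smul a))
  have hWc : Continuous W :=
    ((continuous_const.mul (hJU.sub continuous_const)).smul hVc).sub continuous_const
  have hWp : Function.Periodic W (2 * Real.pi) := fun τ => by
    simp only [hW, periodic_ditherU hk τ, periodic_ditherV hk τ]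
  set A := ∫ τ in -Real.pi..Real.pi, J (x s + a • ditherU m k τ) • ditherV m k τ with hAdef
  set B := ∫ τ in -Real.pi..Real.pi, ditherV m k τ with hBdef
  have hWint : ∫ τ in -Real.pi..Real.pi, W τ = b • ((A - (2 * Real.pi) • D) - η s • B) := by
    have e : W = fun τ => b • ((J (x s + a • ditherU m k τ) • ditherV m k τ - D) -
        η s • ditherV m k τ) := by
      ext1 τ
      simp only [hW]
      module
    have i1 : Continuous fun τ => J (x s + a • ditherU m k τ) • ditherV m k τ := hJU.smul hVc
    have i2 : Continuous fun τ => J (x s + a • ditherU m k τ) • ditherV m k τ - D :=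
      i1.sub continuous_const
    have i3 : Continuous fun τ => η s • ditherV m k τ := hVc.const_smul (η s)
    rw [e, intervalIntegral.integral_smul, intervalIntegral.integral_sub
      (i2.intervalIntegrable _ _) (i3.intervalIntegrable _ _),
      intervalIntegral.integral_sub (i1.intervalIntegrable _ _) intervalIntegrable_const,
      intervalIntegral.integral_smul, intervalIntegral.integral_const]
    congr 4
    ring
  have hfrozen : ‖∫ r in s..s + 2 * Real.pi / ω, W (ω * r)‖ ≤
      2 * Real.pi / ω * (b * (1 + ρ) * κ) := by
    rw [integral_period_comp_mul hWp hω, hWint, norm_smul, norm_smul, norm_inv, Real.norm_eq_abs,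
      Real.norm_eq_abs, abs_of_pos hω, abs_of_nonneg hb]
    have h1 : ‖(A - (2 * Real.pi) • D) - η s • B‖ ≤ (1 + ρ) * κ := by
      refine (norm_sub_le _ _).trans ?_
      rw [norm_smul, Real.norm_eq_abs]
      have : |η s| * ‖B‖ ≤ ρ * κ := by gcongr; exact (abs_nonneg _).trans hηρ
      linarith
    have hρ := (abs_nonneg _).trans hηρ
    have h2 : ω⁻¹ ≤ 2 * Real.pi / ω := by
      rw [inv_eq_one_div]
      gcongr
      linarith [Real.pi_gt_three]
    calc ω⁻¹ * (b * ‖(A - (2 * Real.pi) • D) - η s • B‖)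
        ≤ 2 * Real.pi / ω * (b * ((1 + ρ) * κ)) := by gcongr
      _ = _ := by ring
  have hdiff : ‖(∫ r in s..s + 2 * Real.pi / ω, ((b * (J (x r + a • ditherU m k (ω * r)) - η r)) •
      ditherV m k (ω * r) - b • averagedField J a (x r))) -
      ∫ r in s..s + 2 * Real.pi / ω, W (ω * r)‖ ≤
      2 * Real.pi / ω * (b * (2 * L * eₓ + eη)) := by
    have hWω : Continuous fun r => W (ω * r) := hWc.comp (continuous_const.mul continuous_id)
    rw [← intervalIntegral.integral_sub hint (hWω.intervalIntegrable _ _)]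
    refine (intervalIntegral.norm_integral_le_of_norm_le_const
      (C := b * (2 * L * eₓ + eη)) fun r hr => ?_).trans_eq ?_
    · rw [uIoc_of_le (by linarith)] at hr
      have hr' : r ∈ Icc s (s + 2 * Real.pi / ω) := Ioc_subset_Icc_self hr
      have hadd : ∀ q ∈ Icc s (s + 2 * Real.pi / ω), ∀ u : EuclideanSpace ℝ (Fin (m + 2)),
          ‖u‖ = 1 → ‖x q + a • u‖ ≤ R + a := fun q hq u hu => by
        refine (norm_add_le _ _).trans (add_le_add (hxR q hq) ?_)
        rw [norm_smul, hu, mul_one, Real.norm_eq_abs, abs_of_nonneg ha]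
      have hJd : ∀ u : EuclideanSpace ℝ (Fin (m + 2)), ‖u‖ = 1 →
          |J (x r + a • u) - J (x s + a • u)| ≤ L * eₓ := fun u hu => by
        refine (hL _ _ (hadd r hr' u hu) (hadd s hs u hu)).trans ?_
        rw [add_sub_add_right_eq_sub]
        gcongr
        exact hx r hr'
      have h1 := hJd _ (norm_ditherU k (ω * r))
      have h2 := norm_averagedField_sub_le hJ hJd
      have h3 := hη r hr'
      have e : (b * (J (x r + a • ditherU m k (ω * r)) - η r)) • ditherV m k (ω * r) -
          b • averagedField J a (x r) - W (ω * r) =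
          b • ((((J (x r + a • ditherU m k (ω * r)) - J (x s + a • ditherU m k (ω * r))) -
            (η r - η s)) • ditherV m k (ω * r)) -
            (averagedField J a (x r) - averagedField J a (x s))) := by
        simp only [hW, hD]
        module
      rw [e, norm_smul, Real.norm_eq_abs, abs_of_nonneg hb]
      gcongr
      refine (norm_sub_le _ _).trans ?_
      rw [norm_smul, Real.norm_eq_abs]
      have h4 : |(J (x r + a • ditherU m k (ω * r)) - J (x s + a • ditherU m k (ω * r))) -
            (η r - η s)| * ‖ditherV m k (ω * r)‖ ≤ L * eₓ + eη :=
        (mul_le_of_le_one_right (abs_nonneg _) (norm_ditherV_le _ _)).trans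
          ((abs_sub _ _).trans (add_le_add h1 h3))
      linarith
    · rw [add_sub_cancel_left, abs_of_pos hP]
      ring
  have h5 := norm_le_insert' (∫ r in s..s + 2 * Real.pi / ω,
    ((b * (J (x r + a • ditherU m k (ω * r)) - η r)) •
      ditherV m k (ω * r) - b • averagedField J a (x r))) (∫ r in s..s + 2 * Real.pi / ω, W (ω * r))
  rw [mul_add]
  linarith

/-- As long as the closed loop stays in a set where `J` is controlled, it is close to the reduced
system. -/
theorem norm_closedLoop_sub_reduced_le {J : EuclideanSpace ℝ (Fin (m + 2)) → ℝ}
    (hJ : ContDiff ℝ 1 J) {a b h ω κ ρ δ R L T t₀ t₁ : ℝ} (ha : 0 ≤ a) (hb : 0 ≤ b) (hh : 0 ≤ h)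
    (hω : 0 < ω) (hκ : 0 ≤ κ) {k : ℕ} (hk : 0 < k)
    {S : Set (EuclideanSpace ℝ (Fin (m + 2)))} (hSR : ∀ x ∈ S, ‖x‖ ≤ R)
    (hL : ∀ x y, ‖x‖ ≤ R + a → ‖y‖ ≤ R + a → |J x - J y| ≤ L * ‖x - y‖) (hL0 : 0 ≤ L)
    (hδ : 0 ≤ δ) (hbound : ∀ x ∈ S, ∀ s, ‖s‖ = 1 → |J (x + a • s)| + δ ≤ ρ)
    (hA : ∀ x ∈ S, ‖(∫ τ in -Real.pi..Real.pi, J (x + a • ditherU m k τ) • ditherV m k τ) -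
      (2 * Real.pi) • averagedField J a x‖ ≤ κ)
    (hB : ‖∫ τ in -Real.pi..Real.pi, ditherV m k τ‖ ≤ κ)
    {d : ℝ → ℝ} (hdδ : ∀ᵐ t, |d t| ≤ δ)
    {x₀ : EuclideanSpace ℝ (Fin (m + 2))} {η₀ : ℝ}
    {xbar : ℝ → EuclideanSpace ℝ (Fin (m + 2))} {z : ℝ → EuclideanSpace ℝ (Fin (m + 2)) × ℝ}
    (hxbar : IsSolution (reducedField J a b ω k d) t₀ x₀ (Icc t₀ t₁) xbar)
    (hz : IsSolution (closedLoopField J a b h ω k d) t₀ (x₀, η₀) (Icc t₀ t₁) z)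
    (hT : t₁ - t₀ ≤ T)
    (hxbarS : ∀ t ∈ Icc t₀ t₁, xbar t ∈ S) (hzS : ∀ t ∈ Icc t₀ t₁, (z t).1 ∈ S)
    (hzρ : ∀ t ∈ Icc t₀ t₁, |(z t).2| ≤ ρ) :
    ∀ t ∈ Icc t₀ t₁, ‖(z t).1 - xbar t‖ ≤
      (T * (b * (1 + ρ) * κ) + 2 * Real.pi / ω *
        (T * (b * (4 * L * b * ρ + 2 * h * ρ)) + 3 * b * ρ)) * Real.exp (b * L * T) := by
  intro t ht
  have hpi := Real.pi_pos
  set P := 2 * Real.pi / ω with hP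
  have hP0 : 0 < P := by positivity
  have h01 : t₀ ≤ t₁ := ht.1.trans ht.2
  have ht₁ : t₁ ∈ Icc t₀ t₁ := right_mem_Icc.2 h01
  have hρ : 0 ≤ ρ := (abs_nonneg _).trans (hzρ t ht)
  have hUc := continuous_ditherU (m := m) k
  have hVc := continuous_ditherV (m := m) k
  have hzc : ContinuousOn z (Icc t₀ t₁) := by
    have := hz.continuousOn ht₁
    rwa [uIcc_of_le h01] at this
  have hxbarc : ContinuousOn xbar (Icc t₀ t₁) := by
    have := hxbar.continuousOn ht₁
    rwa [uIcc_of_le h01] at this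
  have hDL : ∀ x y, x ∈ S → y ∈ S →
      ‖averagedField J a x - averagedField J a y‖ ≤ L * ‖x - y‖ := fun x y hx hy => by
    refine norm_averagedField_sub_le hJ fun s hs => ?_
    have hadd : ∀ q ∈ S, ‖q + a • s‖ ≤ R + a := fun q hq => by
      refine (norm_add_le _ _).trans (add_le_add (hSR q hq) ?_)
      rw [norm_smul, hs, mul_one, Real.norm_eq_abs, abs_of_nonneg ha]
    have := hL _ _ (hadd x hx) (hadd y hy)
    rwa [add_sub_add_right_eq_sub] at this
  have hDc : ContinuousOn (averagedField J a) S := by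
    refine LipschitzOnWith.continuousOn (K := .mk L hL0) (LipschitzOnWith.of_dist_le_mul ?_)
    intro x hx y hy
    rw [dist_eq_norm, dist_eq_norm]
    exact hDL x y hx hy
  have hJρ : ∀ x ∈ S, ∀ s, ‖s‖ = 1 → |J (x + a • s)| ≤ ρ := fun x hx s hs => by
    have := hbound x hx s hs
    linarith
  set x : ℝ → EuclideanSpace ℝ (Fin (m + 2)) := fun t => (z t).1 with hx
  set η : ℝ → ℝ := fun t => (z t).2 with hη
  have hxc : ContinuousOn x (Icc t₀ t₁) := continuous_fst.comp_continuousOn hzc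
  have hηc : ContinuousOn η (Icc t₀ t₁) := continuous_snd.comp_continuousOn hzc
  set y : ℝ → ℝ := fun t => J (x t + a • ditherU m k (ω * t)) - η t with hy
  have hyc : ContinuousOn y (Icc t₀ t₁) :=
    (hJ.continuous.comp_continuousOn (hxc.add
      ((hUc.comp (continuous_const.mul continuous_id)).const_smul a).continuousOn)).sub hηc
  -- The input `J + d` and the state `η` are each bounded by `ρ`. This bounds the speed of both
  -- components independently of `ω`, `k` and `d`.
  have hydρ : ∀ᵐ r, r ∈ Icc t₀ t₁ → |y r + d r| ≤ 2 * ρ := by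
    filter_upwards [hdδ] with r hr hrt
    have h1 := hbound _ (hzS r hrt) _ (norm_ditherU k (ω * r))
    have h2 := hzρ r hrt
    have h3 := abs_add_le (J (x r + a • ditherU m k (ω * r)) - η r) (d r)
    have h4 := abs_sub (J (x r + a • ditherU m k (ω * r))) (η r)
    simp only [hy]
    simp only [hx, hη] at *
    linarith
  have hzeq1 : ∀ r ∈ Icc t₀ t₁, IntervalIntegrable
      (fun s => (b * (y s + d s)) • ditherV m k (ω * s)) volume t₀ r ∧
      x r = x₀ + ∫ s in t₀..r, (b * (y s + d s)) • ditherV m k (ω * s) := fun r hr => by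
    simpa only [closedLoopField_eq] using hz.fst hr
  have hzeq2 : ∀ r ∈ Icc t₀ t₁, IntervalIntegrable (fun s => h * (y s + d s)) volume t₀ r ∧
      η r = η₀ + ∫ s in t₀..r, h * (y s + d s) := fun r hr => by
    simpa only [closedLoopField_eq] using hz.snd hr
  have hxLip : ∀ s ∈ Icc t₀ t₁, ∀ r ∈ Icc t₀ t₁, s ≤ r → ‖x r - x s‖ ≤ 2 * b * ρ * (r - s) :=
    fun s hs r hr hsr => by
      rw [(hzeq1 r hr).2, (hzeq1 s hs).2, add_sub_add_left_eq_sub,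
        intervalIntegral.integral_interval_sub_left (hzeq1 r hr).1 (hzeq1 s hs).1,
        ← abs_of_nonneg (sub_nonneg.2 hsr)]
      refine intervalIntegral.norm_integral_le_of_norm_le_const_ae ?_
      filter_upwards [hydρ] with q hq hqm
      rw [uIoc_of_le hsr] at hqm
      have h1 := hq ⟨hs.1.trans hqm.1.le, hqm.2.trans hr.2⟩
      rw [norm_smul, norm_mul, Real.norm_eq_abs, Real.norm_eq_abs, abs_of_nonneg hb]
      refine (mul_le_of_le_one_right (by positivity) (norm_ditherV_le _ _)).trans ?_
      calc b * |y q + d q| ≤ b * (2 * ρ) := by gcongr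
        _ = 2 * b * ρ := by ring
  have hηLip : ∀ s ∈ Icc t₀ t₁, ∀ r ∈ Icc t₀ t₁, s ≤ r → |η r - η s| ≤ 2 * h * ρ * (r - s) :=
    fun s hs r hr hsr => by
      rw [(hzeq2 r hr).2, (hzeq2 s hs).2, add_sub_add_left_eq_sub,
        intervalIntegral.integral_interval_sub_left (hzeq2 r hr).1 (hzeq2 s hs).1,
        ← abs_of_nonneg (sub_nonneg.2 hsr), ← Real.norm_eq_abs]
      refine intervalIntegral.norm_integral_le_of_norm_le_const_ae ?_
      filter_upwards [hydρ] with q hq hqm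
      rw [uIoc_of_le hsr] at hqm
      have h1 := hq ⟨hs.1.trans hqm.1.le, hqm.2.trans hr.2⟩
      rw [norm_mul, Real.norm_eq_abs, Real.norm_eq_abs, abs_of_nonneg hh]
      calc h * |y q + d q| ≤ h * (2 * ρ) := by gcongr
        _ = 2 * h * ρ := by ring
  set F : ℝ → EuclideanSpace ℝ (Fin (m + 2)) := fun r =>
    (b * y r) • ditherV m k (ω * r) - b • averagedField J a (x r) with hF
  have hDx : ContinuousOn (fun r => averagedField J a (x r)) (Icc t₀ t₁) := hDc.comp hxc hzS
  have hDxbar : ContinuousOn (fun r => averagedField J a (xbar r)) (Icc t₀ t₁) :=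
    hDc.comp hxbarc hxbarS
  have hFc : ContinuousOn F (Icc t₀ t₁) :=
    ((continuousOn_const.mul hyc).smul
      (hVc.comp (continuous_const.mul continuous_id)).continuousOn).sub (hDx.const_smul b)
  have hsubI : ∀ {u v}, u ∈ Icc t₀ t₁ → v ∈ Icc t₀ t₁ → uIcc u v ⊆ Icc t₀ t₁ :=
    fun hu hv => ordConnected_Icc.uIcc_subset hu hv
  have ht₀ : t₀ ∈ Icc t₀ t₁ := left_mem_Icc.2 h01
  have hFM : ∀ r ∈ Icc t₀ t₁, ‖F r‖ ≤ 3 * b * ρ := fun r hr => by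
    have h1 : |y r| ≤ 2 * ρ := by
      have := abs_sub (J (x r + a • ditherU m k (ω * r))) (η r)
      have := hJρ _ (hzS r hr) _ (norm_ditherU k (ω * r))
      have := hzρ r hr
      simp only [hy, hx, hη] at *
      linarith
    have h2 := norm_averagedField_le hJ (hJρ _ (hzS r hr))
    refine (norm_sub_le _ _).trans ?_
    rw [norm_smul, norm_smul, norm_mul, Real.norm_eq_abs, Real.norm_eq_abs, abs_of_nonneg hb]
    have h3 : b * |y r| * ‖ditherV m k (ω * r)‖ ≤ b * (2 * ρ) :=
      (mul_le_of_le_one_right (by positivity) (norm_ditherV_le _ _)).trans (by gcongr)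
    have h4 : b * ‖averagedField J a (x r)‖ ≤ b * ρ := by gcongr
    linarith
  -- The drifts of `x` and `η` over one period are at most `2bρP` and `2hρP`.
  set κ' := b * (2 * L * (2 * b * ρ * P) + 2 * h * ρ * P) + b * (1 + ρ) * κ with hκ'
  have hFint : ∀ r ∈ Icc t₀ t₁, ‖∫ s in t₀..r, F s‖ ≤ (r - t₀) * κ' + P * (3 * b * ρ) := by
    refine norm_integral_le_of_period hP0 (by positivity) (by positivity)
      ((hFc.mono (hsubI ht₀ ht₁)).intervalIntegrable) hFM fun s hs hsP => ?_
    have hsub : Icc s (s + P) ⊆ Icc t₀ t₁ := Icc_subset_Icc hs hsP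
    have hs' : s ∈ Icc t₀ t₁ := hsub ⟨le_rfl, by linarith⟩
    refine norm_integral_period_le hJ ha hb hω hk hL hL0 (fun r hr => hSR _ (hzS r (hsub hr)))
      (fun r hr => ?_) (fun r hr => ?_) (hzρ s hs') (hA _ (hzS s hs')) hB ?_
    · refine (hxLip s hs' r (hsub hr) hr.1).trans ?_
      gcongr
      linarith [hr.2]
    · refine (hηLip s hs' r (hsub hr) hr.1).trans ?_
      gcongr
      linarith [hr.2]
    · exact (hFc.mono (hsubI hs' (hsub ⟨by linarith, le_rfl⟩))).intervalIntegrable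
  set e := T * (b * (1 + ρ) * κ) + P * (T * (b * (4 * L * b * ρ + 2 * h * ρ)) + 3 * b * ρ) with he
  have hT0 : 0 ≤ T := (sub_nonneg.2 h01).trans hT
  have he0 : 0 ≤ e := by positivity
  have huc : ContinuousOn (fun r => ‖x r - xbar r‖) (Icc t₀ t₁) := (hxc.sub hxbarc).norm
  have hgron := le_mul_exp_of_le_add_integral (u := fun r => ‖x r - xbar r‖) (e := e)
    (L := b * L) (by positivity) huc (fun r hr => by
      obtain ⟨i1, e1⟩ := hzeq1 r hr
      obtain ⟨i2, e2⟩ := hxbar.2.2 r hr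
      simp only [reducedField_eq] at i2 e2
      have i3 : IntervalIntegrable F volume t₀ r := (hFc.mono (hsubI ht₀ hr)).intervalIntegrable
      have i4 : IntervalIntegrable (fun s => b • (averagedField J a (x s) -
          averagedField J a (xbar s))) volume t₀ r :=
        (((hDx.sub hDxbar).const_smul b).mono (hsubI ht₀ hr)).intervalIntegrable
      -- The disturbance terms of the two systems are identical and cancel; what remains is the
      -- averaging error `F` and a Lipschitz term for Grönwall.
      have e3 : x r - xbar r = (∫ s in t₀..r, F s) +
          ∫ s in t₀..r, b • (averagedField J a (x s) - averagedField J a (xbar s)) := by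
        rw [e1, e2, add_sub_add_left_eq_sub, ← intervalIntegral.integral_sub i1 i2,
          ← intervalIntegral.integral_add i3 i4]
        congr 1
        ext1 s
        simp only [hF]
        module
      have h1 : ‖∫ s in t₀..r, b • (averagedField J a (x s) - averagedField J a (xbar s))‖ ≤
          b * L * ∫ s in t₀..r, ‖x s - xbar s‖ := by
        rw [← intervalIntegral.integral_const_mul]
        refine intervalIntegral.norm_integral_le_of_norm_le hr.1
          (Eventually.of_forall fun s hs => ?_)
          (((huc.mono (hsubI ht₀ hr)).intervalIntegrable).const_mul _)
        have hs' : s ∈ Icc t₀ t₁ := ⟨hs.1.le, hs.2.trans hr.2⟩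
        rw [norm_smul, Real.norm_eq_abs, abs_of_nonneg hb, mul_assoc]
        gcongr
        exact hDL _ _ (hzS s hs') (hxbarS s hs')
      have h2 := hFint r hr
      have h3 : (r - t₀) * κ' ≤ T * κ' := by
        gcongr
        linarith [hr.2]
      rw [e3]
      refine (norm_add_le _ _).trans (add_le_add (h2.trans ?_) h1)
      have : e = T * κ' + P * (3 * b * ρ) := by
        simp only [he, hκ']
        ring
      linarith) t ht
  refine hgron.trans ?_
  gcongr
  linarith [ht.2]

end AveragedES

/-! ### Invariance of the filter state and truncation of the objective. -/

namespace AveragedES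

open Set Filter Topology

/-- The interval `[-ρ, ρ]` is invariant for a stable first order filter with input in `[-ρ, ρ]`. -/
theorem abs_le_of_saturated_filter {q η : ℝ → ℝ} {t₀ t₁ h ρ : ℝ} (hh : 0 ≤ h) (hρ : 0 ≤ ρ)
    (hη : ContinuousOn η (Icc t₀ t₁))
    (hint : IntervalIntegrable (fun s => h * (q s - max (-ρ) (min ρ (η s)))) volume t₀ t₁)
    (heq : ∀ t ∈ Icc t₀ t₁, η t = η t₀ + ∫ s in t₀..t, h * (q s - max (-ρ) (min ρ (η s))))
    (h0 : |η t₀| ≤ ρ) (hq : ∀ᵐ s, s ∈ Icc t₀ t₁ → |q s| ≤ ρ) :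
    ∀ t ∈ Icc t₀ t₁, |η t| ≤ ρ := by
  intro t ht
  refine abs_le'.2 ⟨?_, ?_⟩
  · refine le_of_integral_barrier hη hint heq (abs_le'.1 h0).1 ?_ t ht
    filter_upwards [hq] with s hs hst hlt
    -- Above `ρ` the saturated state equals `ρ`, so the derivative is `h * (q s - ρ) ≤ 0`.
    rw [min_eq_left hlt.le, max_eq_right (by linarith)]
    have := (abs_le.1 (hs hst)).2
    exact mul_nonpos_of_nonneg_of_nonpos hh (by linarith)
  · refine le_of_integral_barrier (η := fun t => -η t) hη.neg hint.neg (fun t ht => ?_)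
      (abs_le'.1 h0).2 ?_ t ht
    · simp only [Pi.neg_apply, intervalIntegral.integral_neg]
      rw [heq t ht]
      ring
    · filter_upwards [hq] with s hs hst hlt
      rw [Pi.neg_apply, max_eq_left ((min_le_right _ _).trans (by linarith))]
      have := (abs_le.1 (hs hst)).1
      have := mul_nonneg hh (by linarith : 0 ≤ q s - -ρ)
      simpa using this

/-- Truncation of a smooth function to a compactly supported one. -/
theorem exists_truncation {m : ℕ} {J : EuclideanSpace ℝ (Fin (m + 2)) → ℝ} (hJ : ContDiff ℝ 1 J)
    {R : ℝ} (hR : 0 < R) : ∃ G : EuclideanSpace ℝ (Fin (m + 2)) → ℝ, ContDiff ℝ 1 G ∧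
      HasCompactSupport G ∧ ∀ x, ‖x‖ ≤ R → G x = J x := by
  let f : ContDiffBump (0 : EuclideanSpace ℝ (Fin (m + 2))) := ⟨R, R + 1, hR, by linarith⟩
  refine ⟨fun x => f x * J x, f.contDiff.mul hJ, f.hasCompactSupport.mul_right, fun x hx => ?_⟩
  have : f x = 1 := f.one_of_mem_closedBall (by simpa using hx)
  simp only [this, one_mul]

end AveragedES

/-! ### Choice of the parameters and the bootstrap. -/

open AveragedES

theorem proposition1 (m : ℕ)
    (J : EuclideanSpace ℝ (Fin (m + 2)) → ℝ) (hJ : ContDiff ℝ ((⊤ : ℕ∞) : WithTop ℕ∞) J)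
    (a b h : ℝ) (ha : 0 < a) (hb : 0 < b) (hh : 0 < h)
    (Kbar Ktilde : Set (EuclideanSpace ℝ (Fin (m + 2))))
    (hKbar : IsCompact Kbar) (hKtilde : IsCompact Ktilde) (hK : Kbar ⊆ interior Ktilde)
    (δ ρ : ℝ) (hδ : 0 < δ) (hρ : 0 < ρ)
    (hbound : ∀ x ∈ Ktilde, ∀ s ∈ Metric.sphere (0 : EuclideanSpace ℝ (Fin (m + 2))) 1,
      |J (x + a • s)| + δ ≤ ρ) :
    ∀ T : ℝ, 0 < T → ∀ ε : ℝ, 0 < ε →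
      ∃ ω₀ : ℝ, 0 < ω₀ ∧ ∃ k₀ : ℕ, 0 < k₀ ∧
        ∀ ω : ℝ, ω₀ ≤ ω → ∀ k : ℕ, k₀ ≤ k →
        ∀ d : ℝ → ℝ, MemLp d ∞ volume → eLpNorm d ∞ volume ≤ ENNReal.ofReal δ →
        ∀ t₀ : ℝ, ∀ x₀ ∈ Kbar, ∀ η₀ : ℝ, |η₀| ≤ ρ →
        ∀ (Ibar : Set ℝ) (xbar : ℝ → EuclideanSpace ℝ (Fin (m + 2))),
          AveragedES.IsMaximalSolution (AveragedES.reducedField J a b ω k d) t₀ x₀ Ibar xbar →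
          Set.Icc t₀ (t₀ + T) ⊆ Ibar →
          (∀ t ∈ Set.Icc t₀ (t₀ + T), xbar t ∈ Kbar) →
          (∃ (I : Set ℝ) (z : ℝ → EuclideanSpace ℝ (Fin (m + 2)) × ℝ),
            AveragedES.IsMaximalSolution
              (AveragedES.closedLoopField J a b h ω k d) t₀ (x₀, η₀) I z) ∧
          ∀ (I : Set ℝ) (z : ℝ → EuclideanSpace ℝ (Fin (m + 2)) × ℝ),
            AveragedES.IsMaximalSolution
              (AveragedES.closedLoopField J a b h ω k d) t₀ (x₀, η₀) I z →
            Set.Icc t₀ (t₀ + T) ⊆ I ∧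
              ∀ t ∈ Set.Icc t₀ (t₀ + T), ‖(z t).1 - xbar t‖ ≤ ε ∧ |(z t).2| ≤ ρ := by
  intro T hT ε hε
  have hpi := Real.pi_pos
  have hJ1 : ContDiff ℝ 1 J := hJ.of_le (by exact_mod_cast le_top)
  have hKbarK : Kbar ⊆ Ktilde := hK.trans interior_subset
  have hbound' : ∀ x ∈ Ktilde, ∀ s : EuclideanSpace ℝ (Fin (m + 2)), ‖s‖ = 1 →
      |J (x + a • s)| + δ ≤ ρ := fun x hx s hs => hbound x hx s (by simpa using hs)
  obtain ⟨ε₁, hε₁, hthick⟩ := hKbar.exists_cthickening_subset_open isOpen_interior hK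
  -- A curve within `ε₁` of `Kbar` stays in `Ktilde`, so closeness to the reduced solution is also
  -- confinement.
  set ε' := min ε ε₁ with hε'def
  have hε' : 0 < ε' := lt_min hε hε₁
  obtain ⟨R, hR, hKR⟩ := hKtilde.isBounded.exists_pos_norm_le
  obtain ⟨L, hL0, hL⟩ := exists_lipschitz_closedBall hJ1 (R + a)
  set X := Real.exp (b * L * T) with hX
  have hX0 : 0 < X := Real.exp_pos _
  set C := T * (b * (4 * L * b * ρ + 2 * h * ρ)) + 3 * b * ρ with hC
  have hC0 : 0 < C := by positivity
  -- `κ`, and below it the lower bound for `ω`, are chosen so that each of the two terms in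
  -- `norm_closedLoop_sub_reduced_le` is at most `ε' / 4`.
  set κ := ε' / (4 * (T * (b * (1 + ρ))) * X) with hκ
  have hκ0 : 0 < κ := by positivity
  obtain ⟨k₁, hk₁, hA⟩ := exists_forall_norm_integral_dither_sub_le hJ1 a hKtilde hκ0
  obtain ⟨k₂, hk₂, hB⟩ := exists_forall_norm_integral_ditherV_le m hκ0
  refine ⟨2 * Real.pi * (4 * C * X) / ε', by positivity, max k₁ k₂, lt_max_of_lt_left hk₁, ?_⟩
  intro ω hω k hk d hd hdδ t₀ x₀ hx₀ η₀ hη₀ Ibar xbar hxbar hIbar hxbarK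
  have hω0 : 0 < ω := lt_of_lt_of_le (by positivity) hω
  have hk0 : 0 < k := hk₁.trans_le ((le_max_left _ _).trans hk)
  have hdae := ae_abs_le_of_eLpNorm_le hδ.le hdδ
  have hLip := lipschitzOnBounded_closedLoopField hJ1 a b h ω k d
  refine ⟨exists_isMaximalSolution hLip _ _, fun I z' hz' => ?_⟩
  set t₁ := t₀ + T with ht₁
  have h01 : t₀ ≤ t₁ := by linarith
  have hxbar' : IsSolution (reducedField J a b ω k d) t₀ x₀ (Set.Icc t₀ t₁) xbar :=
    hxbar.1.mono hIbar Set.ordConnected_Icc (Set.left_mem_Icc.2 h01)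
  have herr : (T * (b * (1 + ρ) * κ) + 2 * Real.pi / ω * C) * X ≤ ε' / 2 := by
    have h1 : T * (b * (1 + ρ) * κ) * X = ε' / 4 := by
      rw [hκ]; field_simp
    have h2 : 2 * Real.pi / ω * C * X ≤ ε' / 4 := by
      rw [div_le_iff₀ hε'] at hω
      rw [div_mul_eq_mul_div, div_mul_eq_mul_div, div_le_iff₀ hω0]
      linarith
    linarith
  obtain ⟨G, hG, hGs, hGJ⟩ := exists_truncation hJ1 (R := R + a) (by positivity)
  obtain ⟨z, hz⟩ := exists_isSolution_saturated hG hGs (a := a) (b := b) (h := h) (ω := ω) hρ.le k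
    hd h01 (x₀, η₀)
  have hGU : ∀ x ∈ Ktilde, ∀ τ, G (x + a • ditherU m k τ) = J (x + a • ditherU m k τ) :=
    fun x hx τ => hGJ _ ((norm_add_le _ _).trans (add_le_add (hKR x hx) (by
      rw [norm_smul, norm_ditherU, mul_one, Real.norm_eq_abs, abs_of_pos ha])))
  have hz0 : z t₀ = (x₀, η₀) := by
    simpa using (hz.2.2 t₀ (Set.left_mem_Icc.2 h01)).2
  have hxbar0 : xbar t₀ = x₀ := by
    simpa using (hxbar'.2.2 t₀ (Set.left_mem_Icc.2 h01)).2
  -- While `z` is `ε'`-close, its first component lies in `Ktilde`, where `G` and `J` agree at the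
  -- sampled points. The filter then keeps `|η| ≤ ρ`, the saturation is the identity, and `z` solves
  -- the original system.
  have hgood : ∀ t ∈ Set.Icc t₀ t₁, (∀ s ∈ Set.Icc t₀ t, ‖(z s).1 - xbar s‖ ≤ ε') →
      (∀ s ∈ Set.Icc t₀ t, (z s).1 ∈ Ktilde) ∧ (∀ s ∈ Set.Icc t₀ t, |(z s).2| ≤ ρ) ∧
      IsSolution (closedLoopField J a b h ω k d) t₀ (x₀, η₀) (Set.Icc t₀ t) z := by
    intro t ht hclose
    have hsub : Set.Icc t₀ t ⊆ Set.Icc t₀ t₁ := Set.Icc_subset_Icc_right ht.2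
    have hmem : ∀ s ∈ Set.Icc t₀ t, (z s).1 ∈ Ktilde := fun s hs =>
      interior_subset (hthick (Metric.mem_cthickening_of_dist_le _ (xbar s) _ _
        (hxbarK s (hsub hs)) (by
          rw [dist_eq_norm]
          exact (hclose s hs).trans (min_le_right _ _))))
    have hzt := hz.mono hsub Set.ordConnected_Icc (Set.left_mem_Icc.2 ht.1)
    have hzc : ContinuousOn z (Set.Icc t₀ t) := by
      have := hzt.continuousOn (Set.right_mem_Icc.2 ht.1)
      rwa [Set.uIcc_of_le ht.1] at this
    have hη : ∀ s ∈ Set.Icc t₀ t, |(z s).2| ≤ ρ := by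
      have hsnd : ∀ s ∈ Set.Icc t₀ t, _ := fun s hs => hzt.snd hs
      have hfield : ∀ r, h * (G ((z r).1 + a • ditherU m k (ω * r)) -
          max (-ρ) (min ρ (z r).2) + d r) = h * ((G ((z r).1 + a • ditherU m k (ω * r)) + d r) -
          max (-ρ) (min ρ (z r).2)) := fun r => by ring
      simp only [closedLoopField_eq, hfield] at hsnd
      refine abs_le_of_saturated_filter (η := fun r => (z r).2) hh.le hρ.le
        (continuous_snd.comp_continuousOn hzc) (hsnd t (Set.right_mem_Icc.2 ht.1)).1
        (fun s hs => ?_) (by simpa [hz0] using hη₀) ?_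
      · rw [(hsnd s hs).2, hz0]
      · filter_upwards [hdae] with r hr hrt
        rw [hGU _ (hmem r hrt)]
        have h1 := hbound' _ (hmem r hrt) _ (norm_ditherU k (ω * r))
        exact (abs_add_le _ _).trans (by linarith)
    refine ⟨hmem, hη, hzt.1, hzt.2.1, fun s hs => ?_⟩
    have hcongr : ∀ r ∈ Set.uIcc t₀ s,
        closedLoopField G a b h ω k d r ((z r).1, max (-ρ) (min ρ (z r).2)) =
          closedLoopField J a b h ω k d r (z r) := fun r hr => by
      rw [Set.uIcc_of_le hs.1] at hr
      have hr' : r ∈ Set.Icc t₀ t := ⟨hr.1, hr.2.trans hs.2⟩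
      have h1 := abs_le.1 (hη r hr')
      rw [closedLoopField_eq, closedLoopField_eq, hGU _ (hmem r hr'), min_eq_right h1.2,
        max_eq_right h1.1]
    obtain ⟨i1, e1⟩ := hzt.2.2 s hs
    refine ⟨i1.congr fun r hr => hcongr r (Set.uIoc_subset_uIcc hr), ?_⟩
    rw [e1]
    congr 1
    exact intervalIntegral.integral_congr hcongr
  have hzc : ContinuousOn z (Set.Icc t₀ t₁) := by
    have := hz.continuousOn (Set.right_mem_Icc.2 h01)
    rwa [Set.uIcc_of_le h01] at this
  have hxbarc : ContinuousOn xbar (Set.Icc t₀ t₁) := by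
    have := hxbar'.continuousOn (Set.right_mem_Icc.2 h01)
    rwa [Set.uIcc_of_le h01] at this
  have hclose : ∀ t ∈ Set.Icc t₀ t₁, ‖(z t).1 - xbar t‖ ≤ ε' / 2 := by
    refine le_half_of_bootstrap hε' ((continuous_fst.comp_continuousOn hzc).sub hxbarc).norm
      (by simp [hz0, hxbar0]) fun t ht hs => ?_
    obtain ⟨h1, h2, h3⟩ := hgood t ht hs
    have hsub : Set.Icc t₀ t ⊆ Set.Icc t₀ t₁ := Set.Icc_subset_Icc_right ht.2
    have h4 : ∀ x ∈ Ktilde, ‖(∫ τ in -Real.pi..Real.pi, J (x + a • ditherU m k τ) •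
        ditherV m k τ) - (2 * Real.pi) • averagedField J a x‖ ≤ κ := fun x hx => by
      have := hA k ((le_max_left _ _).trans hk) x hx
      rwa [mul_smul] at this
    exact (norm_closedLoop_sub_reduced_le hJ1 ha.le hb.le hh.le hω0 hκ0.le hk0 hKR hL hL0 hδ.le
      hbound' h4 (hB k ((le_max_right _ _).trans hk)) hdae
      (hxbar'.mono hsub Set.ordConnected_Icc (Set.left_mem_Icc.2 ht.1)) h3 (by linarith [ht.2])
      (fun s hs => hKbarK (hxbarK s (hsub hs))) h1 h2 t (Set.right_mem_Icc.2 ht.1)).trans herr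
  obtain ⟨-, h2, h3⟩ := hgood t₁ (Set.right_mem_Icc.2 h01) fun s hs =>
    (hclose s hs).trans (by linarith)
  -- The auxiliary solution, now a solution of (C) on the whole interval, is contained in the
  -- maximal one.
  obtain ⟨hsubI, heq⟩ := hz'.extends hLip h3
  refine ⟨hsubI, fun t ht => ?_⟩
  rw [heq ht]
  exact ⟨(hclose t ht).trans ((half_le_self hε'.le).trans (min_le_left _ _)), h2 t ht⟩
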